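/- Let $G=\mathrm{FI}=F_{4(4)}$, the split real form of the complex group $F_4$, let $K$ be a maximal compact subgroup, let $T$ be a maximal torus of $K$ (also one of $G$, by equal rank), with Lie algebra $\mathfrak t_0$, and let $\mathfrak g=\mathfrak k\oplus\mathfrak p$ be the complexified Cartan decomposition and $\mathfrak t=\mathfrak t_0\otimes_{\mathbb R}\mathbb C$. Identify $i\mathfrak t_0^*$ with $\mathbb R^4$ so that $\Delta(\mathfrak g,\mathfrak t)$ consists of the vectors $\pm e_i$, $\pm e_i\pm e_j$ ($i<j$), $\frac12(\pm e_1\pm e_2\pm e_3\pm e_4)$, and take as simple roots $$\alpha_1=\tfrac12(e_1-e_2-e_3-e_4),\quad \alpha_2=e_4,\quad \alpha_3=e_3-e_4,\quad \alpha_4=e_2-e_3,$$ where $\alpha_4$ is the only noncompact simple root: a root is compact (lies in $\Delta(\mathfrak k,\mathfrak t)$) if its $\alpha_4$-coefficient is even and noncompact (lies in $\Delta(\mathfrak p,\mathfrak t)$) otherwise. Then $\Delta^+(\mathfrak k,\mathfrak t)=\Delta(\mathfrak k,\mathfrak t)\cap\Delta^+(\mathfrak g,\mathfrak t)$ has simple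 roots $\gamma_1=\alpha_1$, $\gamma_2=\alpha_2$, $\gamma_3=\alpha_3$, $\gamma_4=2\alpha_1+4\alpha_2+3\alpha_3+2\alpha_4$ and fundamental weights $\varpi_1,\dots,\varpi_4$. Write $[m_1,m_2,m_3,m_4]=\sum_i m_i\varpi_i$ and let $\rho_c$ be the half sum of $\Delta^+(\mathfrak k,\mathfrak t)$. A $K$-type is identified with its highest weight $\mu$, which is a weight of $T$ dominant for $\Delta^+(\mathfrak k,\mathfrak t)$; the weights of $T$ form the lattice spanned by $\Delta(\mathfrak g,\mathfrak t)$. (Thus the $K$-types are the $[m_1,m_2,m_3,m_4]$ with $m_i\in\mathbb N=\{0,1,2,\dots\}$ and $m_1+m_3+m_4$ even.) Let $\|\cdot\|$ be the norm on $i\mathfrak t_0^*$ given by any positive definite symmetric bilinear form invariant under the Weyl group of $\Delta(\mathfrak g,\mathfrak t)$ (as induced by an invariant symmetric bilinear form on $\mathfrak g$). The lambda norm of a $K$-type $\mu$ is $\|\mu\|_{\rm lambda}=\|\lambda_a(\mu)\|$, where, for any choice of positive roots $(\Delta^+)'(\mathfrak g,\mathfrak t)$ making $\mu+2\rho_c$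 dominant, with half sum $\rho'$, $\lambda_a(\mu)$ is the projection (nearest point) of $\mu+2\rho_c-\rho'$ to the dominant Weyl chamber of $(\Delta^+)'(\mathfrak g,\mathfrak t)$; the norm does not depend on the choice. The spin norm is $$\|\mu\|_{\rm spin}=\min_j\big\|\{\mu-\rho_n^{(j)}\}+\rho_c\big\|,$$ where $j$ runs over the choices of positive roots of $\Delta(\mathfrak g,\mathfrak t)$ containing $\Delta^+(\mathfrak k,\mathfrak t)$, $\rho_n^{(j)}$ is the half sum of the noncompact roots in the $j$-th choice, and $\{\nu\}$ is the unique $\Delta^+(\mathfrak k,\mathfrak t)$-dominant vector conjugate to $\nu$ under the Weyl group $W(\mathfrak k,\mathfrak t)$. Then the $K$-types $\mu$ of $G$ with $\|\mu\|_{\rm spin}=\|\mu\|_{\rm lambda}$ are exactly the weights in the following list, where $a,b,c,d$ run over $\mathbb N$ subject to $a+b>0$, $b+c>0$, $c+d>0$ and to the additional condition stated: 0. $[2b+c+1,\ c+d,\ a+b,\ a+b+c+1]$; 1. $[2a+2b+c+3,\ c+d,\ b-1,\ b+c]$, $b\ge 1$; 2. $[c-1,\ 2b+c+d+2,\ a-1,\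 a+2b+c+2]$, $a,c\ge 1$; 3. $[2b+c+1,\ d-1,\ a+b+c+1,\ a+b]$, $d\ge 1$; 4. $[2b+c+d+2,\ c-1,\ a+b,\ a+b+c+d+2]$, $c\ge 1$; 5. $[2a+2b+c+3,\ d-1,\ b+c,\ b-1]$, $b,d\ge 1$; 6. $[2a+2b+c+d+4,\ c-1,\ b-1,\ b+c+d+1]$, $b,c\ge 1$; 7. $[c+d,\ 2b+c+1,\ a-1,\ a+2b+c+d+3]$, $a\ge 1$; 8. $[c-1,\ d-1,\ a+2b+c+2,\ a-1]$, $a,c,d\ge 1$; 9. $[d-1,\ 2b+c+1,\ a-1,\ a+2b+2c+d+4]$, $a,d\ge 1$; 10. $[d-1,\ c-1,\ a+b,\ a+3b+2c+d+5]$, $c,d\ge 1$; 11. $[d-1,\ c-1,\ b-1,\ 2a+3b+2c+d+6]$, $b,c,d\ge 1$. -/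

import Mathlib

/-!
The group `G = FI = F₄₍₄₎` has equal rank, so its fundamental Cartan subalgebra is the
complexification `t` of a maximal abelian subalgebra `t₀` of `k₀`.  The real vector space
`i t₀*`, which contains all roots and all weights, is identified with `ℝ⁴` in the usual
coordinates of the root system `F₄`.
-/

namespace FI

/-- The space `i t₀*`, with coordinates `e₁, e₂, e₃, e₄`. -/
abbrev Wt : Type := Fin 4 → ℝ

/-- `⟨x, α^∨⟩ = 2 (x, α) / (α, α)`. -/
noncomputable def pairing (x α : Wt) : ℝ := 2 * (x ⬝ᵥ α) / (α ⬝ᵥ α)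

/-- The reflection `s_α x = x - ⟨x, α^∨⟩ α`. -/
noncomputable def refl (α x : Wt) : Wt := x - pairing x α • α

open Classical in
/-- The root system `Δ(g, t)` of type `F₄`:
`± eᵢ`, `± eᵢ ± eⱼ` (`i < j`) and `(± e₁ ± e₂ ± e₃ ± e₄) / 2`. -/
noncomputable def roots : Finset Wt :=
  (Finset.univ.image fun p : ℤˣ × Fin 4 => ((p.1 : ℤ) : ℝ) • (Pi.single p.2 1 : Wt)) ∪
  (((Finset.univ : Finset ((ℤˣ × ℤˣ) × Fin 4 × Fin 4)).filter fun p => p.2.1 < p.2.2).image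
    fun p => ((p.1.1 : ℤ) : ℝ) • (Pi.single p.2.1 1 : Wt) +
      ((p.1.2 : ℤ) : ℝ) • (Pi.single p.2.2 1 : Wt)) ∪
  (Finset.univ.image fun s : Fin 4 → ℤˣ => (fun i => ((s i : ℤ) : ℝ) / 2 : Wt))

/-- The simple roots `α₁, α₂` (short) and `α₃, α₄` (long) of `Δ⁺(g, t)`. -/
noncomputable def simpleRoot : Fin 4 → Wt :=
  ![![1/2, -1/2, -1/2, -1/2], ![0, 0, 0, 1], ![0, 0, 1, -1], ![0, 1, -1, 0]]

open Classical in
/-- `Δ⁺(g, t)`: the roots that are combinations of the simple roots with coefficients in `ℕ`. -/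
noncomputable def posRoots : Finset Wt :=
  roots.filter fun α => ∃ c : Fin 4 → ℕ, α = ∑ i, (c i : ℝ) • simpleRoot i

open Classical in
/-- `Δ(k, t)`.  In the Vogan diagram of `FI` the only painted vertex is `α₄`, and the Cartan
involution fixes `t`; it therefore acts on the root space of `α` by `(-1)^n`, where `n` is the
coefficient of `α₄` in `α`.  So `α` is compact exactly when `n` is even. -/
noncomputable def compactRoots : Finset Wt :=
  roots.filter fun α => ∃ c : Fin 4 → ℤ, α = ∑ i, (c i : ℝ) • simpleRoot i ∧ Even (c 3)

open Classical in
/-- `Δ(p, t)`, the noncompact roots. -/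
noncomputable def noncompactRoots : Finset Wt := roots \ compactRoots

open Classical in
/-- `Δ⁺(k, t)`. -/
noncomputable def posCompactRoots : Finset Wt := compactRoots ∩ posRoots

/-- The half sum of a finite set of roots. -/
noncomputable def halfSum (S : Finset Wt) : Wt := (1 / 2 : ℝ) • ∑ α ∈ S, α

/-- `ρ_c`. -/
noncomputable def rhoC : Wt := halfSum posCompactRoots

open Classical in
/-- A positive system (choice of positive roots) of `Δ(g, t)`: the roots on the positive side of
a hyperplane that contains no root. -/
def IsPositiveSystem (Ψ : Finset Wt) : Prop :=
  ∃ v : Wt, (∀ α ∈ roots, α ⬝ᵥ v ≠ 0) ∧ Ψ = roots.filter fun α => 0 < α ⬝ᵥ v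

/-- `x` is dominant for the set `Ψ` of positive roots. -/
def IsDominant (Ψ : Finset Wt) (x : Wt) : Prop := ∀ α ∈ Ψ, 0 ≤ pairing x α

/-- The Weyl group `W(k, t)`, generated by the reflections in the compact roots. -/
def compactWeylGroup : Subgroup (Wt ≃ₗ[ℝ] Wt) :=
  Subgroup.closure {w | ∃ α ∈ compactRoots, ∀ x, w x = refl α x}

/-- Simple roots `γ₁ = α₁`, `γ₂ = α₂`, `γ₃ = α₃`, `γ₄ = 2α₁ + 4α₂ + 3α₃ + 2α₄`
of `Δ⁺(k, t)`, which has type `C₃ × A₁`. -/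
noncomputable def compactSimpleRoot : Fin 4 → Wt :=
  ![simpleRoot 0, simpleRoot 1, simpleRoot 2,
    (2 : ℝ) • simpleRoot 0 + (4 : ℝ) • simpleRoot 1 + (3 : ℝ) • simpleRoot 2 +
      (2 : ℝ) • simpleRoot 3]

/-- The fundamental weights `ϖ₁, …, ϖ₄` for `Δ⁺(k, t)`, dual to the coroots of `γ₁, …, γ₄`
(see `pairing_fundWeight`). -/
noncomputable def fundWeight : Fin 4 → Wt :=
  ![![1/2, -1/2, 0, 0], ![1/2, -1/2, 1/2, 1/2], ![1/2, -1/2, 1, 0], ![1/2, 1/2, 0, 0]]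

/-- The weight `[m₁, m₂, m₃, m₄] = m₁ ϖ₁ + m₂ ϖ₂ + m₃ ϖ₃ + m₄ ϖ₄`. -/
noncomputable def kWeight (m : Fin 4 → ℤ) : Wt := ∑ i, (m i : ℝ) • fundWeight i

/-- `K`-types, identified with their highest weights.  `K` is connected with maximal torus `T`,
so its irreducible representations correspond to the characters of `T` that are dominant for
`Δ⁺(k, t)`.  `T` is also a maximal torus of the complex group `F₄`, which is both simply
connected and centerless, so the character lattice of `T` is the lattice spanned by the roots. -/
def IsKType (μ : Wt) : Prop :=
  μ ∈ AddSubgroup.closure (roots : Set Wt) ∧ IsDominant posCompactRoots μ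

/-- `B` is the form on `i t₀*` induced by an invariant symmetric bilinear form on `g` (normalized,
as usual, to be positive definite on `i t₀`): symmetric, positive definite and invariant under the
Weyl group `W(g, t)`, that is, under all the root reflections. -/
structure IsInvariantForm (B : LinearMap.BilinForm ℝ Wt) : Prop where
  symm : ∀ x y, B x y = B y x
  pos : ∀ x, x ≠ 0 → 0 < B x x
  invariant : ∀ α ∈ roots, ∀ x y, B (refl α x) (refl α y) = B x y

/-- The norm `‖x‖` induced by the form `B`. -/
noncomputable def formNorm (B : LinearMap.BilinForm ℝ Wt) (x : Wt) : ℝ := √(B x x)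

/-- `p` is the projection of `x` to the dominant Weyl chamber of `Ψ`: the point of this closed
convex cone that is nearest to `x`. -/
def IsChamberProjection (B : LinearMap.BilinForm ℝ Wt) (Ψ : Finset Wt) (x p : Wt) : Prop :=
  IsDominant Ψ p ∧ ∀ q, IsDominant Ψ q → formNorm B (x - p) ≤ formNorm B (x - q)

/-- `r = ‖λ_a(μ)‖`, where `λ_a(μ)` is computed from some positive system `Ψ` making `μ + 2ρ_c`
dominant: with `ρ'` the half sum of `Ψ`, it is the projection of `μ + 2ρ_c - ρ'` to the dominant
chamber of `Ψ`. -/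
def IsLambdaValue (B : LinearMap.BilinForm ℝ Wt) (μ : Wt) (r : ℝ) : Prop :=
  ∃ Ψ : Finset Wt, IsPositiveSystem Ψ ∧ IsDominant Ψ (μ + (2 : ℝ) • rhoC) ∧
    ∃ p, IsChamberProjection B Ψ (μ + (2 : ℝ) • rhoC - halfSum Ψ) p ∧ r = formNorm B p

/-- The lambda norm.  `‖λ_a(μ)‖` does not depend on the positive system used to compute it, so the
set below has exactly one element, and the infimum is that element. -/
noncomputable def lambdaNorm (B : LinearMap.BilinForm ℝ Wt) (μ : Wt) : ℝ :=
  sInf {r | IsLambdaValue B μ r}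

open Classical in
/-- `r = ‖{μ - ρ_n^{(j)}} + ρ_c‖` for some choice `Ψ = (Δ⁺)^{(j)}(g, t)` of positive roots that is
compatible with `Δ⁺(k, t)`; here `ρ_n^{(j)}` is the half sum of the noncompact roots in `Ψ`, and
`ν = {μ - ρ_n^{(j)}}` is the dominant weight that is conjugate to `μ - ρ_n^{(j)}` under
`W(k, t)`. -/
def IsSpinValue (B : LinearMap.BilinForm ℝ Wt) (μ : Wt) (r : ℝ) : Prop :=
  ∃ Ψ : Finset Wt, IsPositiveSystem Ψ ∧ posCompactRoots ⊆ Ψ ∧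
    ∃ w ∈ compactWeylGroup, ∃ ν : Wt, ν = w (μ - halfSum (Ψ ∩ noncompactRoots)) ∧
      IsDominant posCompactRoots ν ∧ r = formNorm B (ν + rhoC)

/-- The spin norm: the minimum of the finitely many values `‖{μ - ρ_n^{(j)}} + ρ_c‖`. -/
noncomputable def spinNorm (B : LinearMap.BilinForm ℝ Wt) (μ : Wt) : ℝ :=
  sInf {r | IsSpinValue B μ r}

/-- The highest weight, in terms of `ϖ₁, …, ϖ₄`, in the row `#x` (`0 ≤ x ≤ 11`) of the table of the
strings with empty support, as a function of the string parameters `a, b, c, d`. -/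
def tableWeight (x : Fin 12) (a b c d : ℤ) : Fin 4 → ℤ :=
  match x with
  | 0 => ![2*b + c + 1, c + d, a + b, a + b + c + 1]
  | 1 => ![2*a + 2*b + c + 3, c + d, b - 1, b + c]
  | 2 => ![c - 1, 2*b + c + d + 2, a - 1, a + 2*b + c + 2]
  | 3 => ![2*b + c + 1, d - 1, a + b + c + 1, a + b]
  | 4 => ![2*b + c + d + 2, c - 1, a + b, a + b + c + d + 2]
  | 5 => ![2*a + 2*b + c + 3, d - 1, b + c, b - 1]
  | 6 => ![2*a + 2*b + c + d + 4, c - 1, b - 1, b + c + d + 1]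
  | 7 => ![c + d, 2*b + c + 1, a - 1, a + 2*b + c + d + 3]
  | 8 => ![c - 1, d - 1, a + 2*b + c + 2, a - 1]
  | 9 => ![d - 1, 2*b + c + 1, a - 1, a + 2*b + 2*c + d + 4]
  | 10 => ![d - 1, c - 1, a + b, a + 3*b + 2*c + d + 5]
  | 11 => ![d - 1, c - 1, b - 1, 2*a + 3*b + 2*c + d + 6]

/-- The additional requirement on the parameters in the row `#x` of the table. -/
def tableCondition (x : Fin 12) (a b c d : ℕ) : Prop :=
  match x with
  | 0 => True
  | 1 => 1 ≤ b
  | 2 => 1 ≤ a ∧ 1 ≤ c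
  | 3 => 1 ≤ d
  | 4 => 1 ≤ c
  | 5 => 1 ≤ b ∧ 1 ≤ d
  | 6 => 1 ≤ b ∧ 1 ≤ c
  | 7 => 1 ≤ a
  | 8 => 1 ≤ a ∧ 1 ≤ c ∧ 1 ≤ d
  | 9 => 1 ≤ a ∧ 1 ≤ d
  | 10 => 1 ≤ c ∧ 1 ≤ d
  | 11 => 1 ≤ b ∧ 1 ≤ c ∧ 1 ≤ d

/-- The weight `μ` occurs in the last column of the table.  The requirements `a + b > 0`,
`b + c > 0`, `c + d > 0` are common to all rows. -/
def IsTableWeight (μ : Wt) : Prop :=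
  ∃ (x : Fin 12) (a b c d : ℕ), 0 < a + b ∧ 0 < b + c ∧ 0 < c + d ∧ tableCondition x a b c d ∧
    μ = kWeight (tableWeight x a b c d)


/-- Coordinates of a combination of simple roots. -/
theorem simpleSum (c : Fin 4 → ℝ) : ∑ i, c i • simpleRoot i =
    ![c 0 / 2, -c 0 / 2 + c 3, -c 0 / 2 + c 2 - c 3, -c 0 / 2 + c 1 - c 2] := by
  funext j
  fin_cases j <;> simp [simpleRoot, Fin.sum_univ_four] <;> ring

theorem compactSimpleRoot_eq : compactSimpleRoot =
    ![![1/2, -1/2, -1/2, -1/2], ![0, 0, 0, 1], ![0, 0, 1, -1], ![1, 1, 0, 0]] := by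
  funext i j
  fin_cases i
  · rfl
  · rfl
  · rfl
  · fin_cases j <;> simp [compactSimpleRoot, simpleRoot] <;> norm_num

/-- The `ϖᵢ` are the fundamental weights: `⟨ϖᵢ, γⱼ^∨⟩ = δᵢⱼ`. -/
theorem pairing_fundWeight (i j : Fin 4) :
    pairing (fundWeight i) (compactSimpleRoot j) = if i = j then 1 else 0 := by
  rw [compactSimpleRoot_eq]
  fin_cases i <;> fin_cases j <;>
    simp [pairing, fundWeight, dotProduct, Fin.sum_univ_four] <;> norm_num

theorem kWeight_eq (m : Fin 4 → ℤ) : kWeight m =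
    ![((m 0 + m 1 + m 2 + m 3 : ℤ) : ℝ) / 2, ((- m 0 - m 1 - m 2 + m 3 : ℤ) : ℝ) / 2,
      ((m 1 + 2 * m 2 : ℤ) : ℝ) / 2, ((m 1 : ℤ) : ℝ) / 2] := by
  funext j
  fin_cases j <;> simp [kWeight, fundWeight, Fin.sum_univ_four] <;> ring

theorem mem_roots_iff (α : Wt) : α ∈ roots ↔
    (∃ (s : ℤˣ) (i : Fin 4), α = ((s : ℤ) : ℝ) • (Pi.single i 1 : Wt)) ∨
    (∃ (s t : ℤˣ) (i j : Fin 4), i < j ∧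
      α = ((s : ℤ) : ℝ) • (Pi.single i 1 : Wt) + ((t : ℤ) : ℝ) • (Pi.single j 1 : Wt)) ∨
    (∃ s : Fin 4 → ℤˣ, α = fun i => ((s i : ℤ) : ℝ) / 2) := by
  simp only [roots, Finset.mem_union, Finset.mem_image, Finset.mem_univ, true_and,
    Finset.mem_filter, Prod.exists, or_assoc, eq_comm (a := α)]

theorem roots_lattice {α : Wt} (h : α ∈ roots) :
    ∃ n : Fin 4 → ℤ, (∀ i, α i = n i / 2) ∧ ∀ i, Even (n i - n 0) := by
  rcases (mem_roots_iff α).1 h with ⟨s, i, rfl⟩ | ⟨s, t, i, j, -, rfl⟩ | ⟨s, rfl⟩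
  · refine ⟨fun k => 2 * (s * (Pi.single i 1 : Fin 4 → ℤ) k), fun k => ?_, fun k => ?_⟩
    · by_cases hk : k = i <;> simp [hk]
    · exact (even_two_mul _).sub (even_two_mul _)
  · refine ⟨fun k => 2 * (s * (Pi.single i 1 : Fin 4 → ℤ) k + t * (Pi.single j 1 : Fin 4 → ℤ) k),
      fun k => ?_, fun k => ?_⟩
    · by_cases hk : k = i <;> by_cases hk' : k = j <;> simp [Pi.single_apply, hk, hk']
    · exact (even_two_mul _).sub (even_two_mul _)
  · refine ⟨fun k => s k, fun k => rfl, fun k => ?_⟩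
    rcases Int.units_eq_one_or (s k) with h | h <;> rcases Int.units_eq_one_or (s 0) with h' | h' <;>
      simp [h, h']

/-- The root lattice: all coordinates integral, or all half-integral. -/
theorem mem_closure_roots_iff (μ : Wt) : μ ∈ AddSubgroup.closure (roots : Set Wt) ↔
    ∃ n : Fin 4 → ℤ, (∀ i, μ i = n i / 2) ∧ ∀ i, Even (n i - n 0) := by
  constructor
  · intro h
    induction h using AddSubgroup.closure_induction with
    | mem x hx => exact roots_lattice hx
    | zero => exact ⟨0, by simp, by simp⟩
    | add x y _ _ hx hy =>
      obtain ⟨n, hn, hn'⟩ := hx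
      obtain ⟨k, hk, hk'⟩ := hy
      refine ⟨n + k, fun i => ?_, fun i => ?_⟩
      · simp [hn, hk]; ring
      · have := (hn' i).add (hk' i)
        rwa [sub_add_sub_comm] at this
    | neg x _ hx =>
      obtain ⟨n, hn, hn'⟩ := hx
      refine ⟨-n, fun i => ?_, fun i => ?_⟩
      · simp [hn]; ring
      · have := (hn' i).neg
        rwa [neg_sub, ← neg_sub_neg] at this
  · rintro ⟨n, hn, hn'⟩
    have he : ∀ i, (Pi.single i 1 : Wt) ∈ AddSubgroup.closure (roots : Set Wt) := fun i =>
      AddSubgroup.subset_closure ((mem_roots_iff _).2 (Or.inl ⟨1, i, by simp⟩))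
    have hh : (fun _ => 1 / 2 : Wt) ∈ AddSubgroup.closure (roots : Set Wt) :=
      AddSubgroup.subset_closure ((mem_roots_iff _).2 (Or.inr (Or.inr ⟨1, by simp⟩)))
    choose k hk using hn'
    have : μ = n 0 • (fun _ => 1 / 2 : Wt) + ∑ i, k i • (Pi.single i 1 : Wt) := by
      funext j
      have h1 : (n j : ℝ) = n 0 + (k j + k j) := by exact_mod_cast (by linarith [hk j])
      simp [Finset.sum_apply, Pi.single_apply, hn, h1]
      ring
    rw [this]
    exact add_mem (zsmul_mem hh _) (sum_mem fun i _ => zsmul_mem (he i) _)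

theorem compactSimpleRoot_mem (j : Fin 4) : compactSimpleRoot j ∈ posCompactRoots := by
  have hr : compactSimpleRoot j ∈ roots := by
    rw [mem_roots_iff, compactSimpleRoot_eq]
    fin_cases j
    · refine Or.inr (Or.inr ⟨![1, -1, -1, -1], ?_⟩)
      funext i; fin_cases i <;> simp
    · refine Or.inl ⟨1, 3, ?_⟩
      funext i; fin_cases i <;> simp
    · refine Or.inr (Or.inl ⟨1, -1, 2, 3, by decide, ?_⟩)
      funext i; fin_cases i <;> simp
    · refine Or.inr (Or.inl ⟨1, 1, 0, 1, by decide, ?_⟩)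
      funext i; fin_cases i <;> simp
  have key : ∃ c : Fin 4 → ℕ, compactSimpleRoot j = ∑ i, (c i : ℝ) • simpleRoot i ∧ Even (c 3) := by
    fin_cases j
    · exact ⟨![1, 0, 0, 0], by simp [compactSimpleRoot, Fin.sum_univ_four], by decide⟩
    · exact ⟨![0, 1, 0, 0], by simp [compactSimpleRoot, Fin.sum_univ_four], by decide⟩
    · exact ⟨![0, 0, 1, 0], by simp [compactSimpleRoot, Fin.sum_univ_four], by decide⟩
    · exact ⟨![2, 4, 3, 2], by simp [compactSimpleRoot, Fin.sum_univ_four], by decide⟩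
  obtain ⟨c, hc, hc'⟩ := key
  simp only [posCompactRoots, compactRoots, posRoots, Finset.mem_inter, Finset.mem_filter]
  exact ⟨⟨hr, fun i => c i, by simpa using hc, by simpa using hc'⟩, hr, c, hc⟩

theorem root_cases {α : Wt} (h : α ∈ roots) : α 0 + α 1 < 2 ∨ α = ![1, 1, 0, 0] := by
  have hs : ∀ s : ℤˣ, ((s : ℤ) : ℝ) = 1 ∨ ((s : ℤ) : ℝ) = -1 := fun s => by
    rcases Int.units_eq_one_or s with h | h <;> simp [h]
  rcases (mem_roots_iff α).1 h with ⟨s, i, rfl⟩ | ⟨s, t, i, j, hij, rfl⟩ | ⟨s, rfl⟩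
  · left
    fin_cases i <;> rcases hs s with h | h <;> norm_num [h]
  · fin_cases i <;> fin_cases j <;> simp at hij <;> rcases hs s with h | h <;>
      rcases hs t with h' | h' <;> simp [h, h']
    all_goals first
      | (left; norm_num; done)
      | (right; funext i; fin_cases i <;> simp)
  · left
    rcases hs (s 0) with h | h <;> rcases hs (s 1) with h' | h' <;> norm_num [h, h']

/-- The parametrization of the `K`-types: they are the `[a, b, c, d]` with `a, b, c, d ∈ ℕ` and
`a + c + d` even. -/
theorem isKType_iff (μ : Wt) : IsKType μ ↔
    ∃ a b c d : ℕ, Even (a + c + d) ∧ μ = kWeight ![a, b, c, d] := by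
  constructor
  · rintro ⟨hl, hd⟩
    obtain ⟨n, hn, hn'⟩ := (mem_closure_roots_iff μ).1 hl
    have h0 := hd _ (compactSimpleRoot_mem 0)
    have h1 := hd _ (compactSimpleRoot_mem 1)
    have h2 := hd _ (compactSimpleRoot_mem 2)
    have h3 := hd _ (compactSimpleRoot_mem 3)
    simp [compactSimpleRoot_eq, pairing, dotProduct, Fin.sum_univ_four, hn] at h0 h1 h2 h3
    norm_num at h0 h1 h2 h3
    obtain ⟨k1, hk1⟩ := hn' 1
    obtain ⟨k2, hk2⟩ := hn' 2
    obtain ⟨k3, hk3⟩ := hn' 3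
    have g0 : (0 : ℝ) ≤ n 0 - n 1 - n 2 - n 3 := by linarith
    have g2 : (0 : ℝ) ≤ n 2 - n 3 := by linarith
    have g3 : (0 : ℝ) ≤ n 0 + n 1 := by linarith
    have g0' : 0 ≤ n 0 - n 1 - n 2 - n 3 := by exact_mod_cast g0
    have g2' : 0 ≤ n 2 - n 3 := by exact_mod_cast g2
    have g3' : 0 ≤ n 0 + n 1 := by exact_mod_cast g3
    have g1 : (0 : ℝ) ≤ n 3 := by linarith
    have g1' : 0 ≤ n 3 := by exact_mod_cast g1
    obtain ⟨a, ha⟩ := Int.eq_ofNat_of_zero_le (show 0 ≤ -k1 - k2 - k3 - n 0 by omega)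
    obtain ⟨b, hb⟩ := Int.eq_ofNat_of_zero_le g1'
    obtain ⟨c, hc⟩ := Int.eq_ofNat_of_zero_le (show 0 ≤ k2 - k3 by omega)
    obtain ⟨d, hd'⟩ := Int.eq_ofNat_of_zero_le (show 0 ≤ n 0 + k1 by omega)
    refine ⟨a, b, c, d, ?_, ?_⟩
    · have : ((a + c + d : ℕ) : ℤ) = 2 * (-k3) := by push_cast; omega
      have h := (even_two_mul (-k3))
      rw [← this] at h
      exact_mod_cast h
    · rw [kWeight_eq]
      have e0 : n 0 = a + b + c + d := by omega
      have e1 : n 1 = -a - b - c + d := by omega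
      have e2 : n 2 = b + 2 * c := by omega
      have e3 : n 3 = b := by omega
      funext j
      fin_cases j <;> simp [hn, e0, e1, e2, e3]
  · rintro ⟨a, b, c, d, he, rfl⟩
    constructor
    · rw [mem_closure_roots_iff, kWeight_eq]
      refine ⟨![a + b + c + d, -a - b - c + d, b + 2 * c, b], fun i => ?_, fun i => ?_⟩
      · fin_cases i <;> simp
      · obtain ⟨k, hk⟩ := he
        fin_cases i
        · simp
        · exact ⟨-a - b - c, by simp; ring⟩
        · exact ⟨c - k, by simp; omega⟩
        · exact ⟨-k, by simp; omega⟩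
    · intro α hα
      simp only [posCompactRoots, compactRoots, posRoots, Finset.mem_inter,
        Finset.mem_filter] at hα
      obtain ⟨⟨hr, p, hp, q, hq⟩, -, r, hr'⟩ := hα
      refine div_nonneg (mul_nonneg zero_le_two ?_) (Finset.sum_nonneg fun i _ => mul_self_nonneg _)
      rw [kWeight_eq]
      rcases root_cases hr with h | h
      · have e1 := congrFun hp
        have e2 := congrFun hr'
        simp only [simpleSum] at e1 e2
        have a0 := e1 0
        have a1 := e1 1
        have b0 := e2 0
        have b1 := e2 1
        have b2 := e2 2
        have b3 := e2 3
        simp at a0 a1 b0 b1 b2 b3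
        have hp3 : (p 3 : ℝ) = r 3 := by linarith
        have hr3 : (r 3 : ℝ) < 2 := by linarith
        have hr3' : r 3 < 2 := by exact_mod_cast hr3
        have hp3' : p 3 = r 3 := by exact_mod_cast hp3
        have hz : r 3 = 0 := by omega
        rw [hz] at b1 b2
        simp [dotProduct, Fin.sum_univ_four, b0, b1, b2, b3]
        have x1 : (0 : ℝ) ≤ a * r 0 := by positivity
        have x2 : (0 : ℝ) ≤ b * r 1 := by positivity
        have x3 : (0 : ℝ) ≤ c * r 2 := by positivity
        nlinarith
      · subst h
        simp [dotProduct, Fin.sum_univ_four]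
        have : (0 : ℝ) ≤ d := by positivity
        linarith

end FI

/-! For a positive system Ψ' containing Δ⁺(k, t), with half sum ρ', one has ρ_n = ρ' - ρ_c, so x = μ
- ρ_n satisfies x + ρ_c = μ + 2ρ_c - ρ'. Let Ψ be any positive system, η = μ + 2ρ_c - ρ_Ψ, and p the
projection of η to the chamber of Ψ. Then x + ρ_c = η + (sum of Ψ \ Ψ'), and p is nonnegative on Ψ,
so p·p ≤ p·η ≤ p·(x + ρ_c), whence ‖p‖ ≤ ‖x + ρ_c‖. Moreover {x} and x have the same length and
{x}·ρ_c ≥ x·ρ_c, so ‖x + ρ_c‖ ≤ ‖{x} + ρ_c‖. Thus each lambda value is at most each spin value, and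
equality forces p = x + ρ_c to be dominant for Ψ' and x to be dominant for Δ⁺(k, t)
(`lambda_le_spin`).

Conversely, if both dominance conditions hold for some Ψ', then μ + 2ρ_c is strictly dominant for
Ψ', no other system can be used for the lambda norm, no projection takes place, and the two norms
agree (`spinNorm_eq_lambdaNorm_iff`).

There are |W(F₄)| / |W(C₃ × A₁)| = 1152 / 96 = 12 systems Ψ', one for each row of the table
(`exists_chamberRoot_pos`). In each of them λ_a = μ + 2ρ_c - ρ' has coordinates a, b, c, d in the
fundamental weights of Ψ'. Dominance says that these are natural numbers, and dominance of λ_a - ρ_c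
for Δ⁺(k, t) gives the inequalities of the row (`tableRow_iff`). -/

namespace FI

/-! ### Roots in doubled integer coordinates, where facts about the 48 roots are decidable. -/

/-- The vectors `2α`, `α` a root, in integer coordinates. -/
def intRoots : Finset (Fin 4 → ℤ) :=
  (Finset.univ.image fun p : ℤˣ × Fin 4 => (2 * (p.1 : ℤ)) • (Pi.single p.2 1 : Fin 4 → ℤ)) ∪
  (((Finset.univ : Finset ((ℤˣ × ℤˣ) × Fin 4 × Fin 4)).filter fun p => p.2.1 < p.2.2).image
    fun p => (2 * (p.1.1 : ℤ)) • (Pi.single p.2.1 1 : Fin 4 → ℤ) +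
      (2 * (p.1.2 : ℤ)) • (Pi.single p.2.2 1 : Fin 4 → ℤ)) ∪
  (Finset.univ.image fun s : Fin 4 → ℤˣ => fun i => (s i : ℤ))

/-- The weight with coordinates `n i / 2`. -/
noncomputable def toWt (n : Fin 4 → ℤ) : Wt := fun i => (n i : ℝ) / 2

theorem toWt_injective : Function.Injective toWt := by
  intro m n h
  funext i
  have := congrFun h i
  simp only [toWt] at this
  exact_mod_cast (by linarith : (m i : ℝ) = n i)

theorem toWt_dotProduct (m n : Fin 4 → ℤ) : toWt m ⬝ᵥ toWt n = ((m ⬝ᵥ n : ℤ) : ℝ) / 4 := by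
  simp [toWt, dotProduct, Fin.sum_univ_four]; ring

theorem toWt_neg (m : Fin 4 → ℤ) : toWt (-m) = -toWt m := by
  funext i; simp [toWt]; ring

theorem toWt_sum {ι : Type*} (s : Finset ι) (f : ι → Fin 4 → ℤ) :
    toWt (∑ i ∈ s, f i) = ∑ i ∈ s, toWt (f i) := by
  funext j; simp [toWt, Finset.sum_div]

theorem roots_eq : roots = intRoots.image toWt := by
  classical
  simp only [roots, intRoots, Finset.image_union, Finset.image_image]
  have h1 (p : ℤˣ × Fin 4) : toWt ((2 * (p.1 : ℤ)) • (Pi.single p.2 1 : Fin 4 → ℤ)) =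
      ((p.1 : ℤ) : ℝ) • (Pi.single p.2 1 : Wt) := by
    funext i; simp [toWt, Pi.single_apply]; split_ifs <;> ring
  have h2 (p : (ℤˣ × ℤˣ) × Fin 4 × Fin 4) : toWt ((2 * (p.1.1 : ℤ)) •
      (Pi.single p.2.1 1 : Fin 4 → ℤ) + (2 * (p.1.2 : ℤ)) • (Pi.single p.2.2 1 : Fin 4 → ℤ)) =
      ((p.1.1 : ℤ) : ℝ) • (Pi.single p.2.1 1 : Wt) +
      ((p.1.2 : ℤ) : ℝ) • (Pi.single p.2.2 1 : Wt) := by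
    funext i; simp [toWt, Pi.single_apply]; split_ifs <;> ring
  simp only [Function.comp_def, h1, h2]
  rfl

theorem forall_roots {P : Wt → Prop} : (∀ α ∈ roots, P α) ↔ ∀ n ∈ intRoots, P (toWt n) := by
  classical
  rw [roots_eq, Finset.forall_mem_image]

theorem toWt_mem_roots {n : Fin 4 → ℤ} : toWt n ∈ roots ↔ n ∈ intRoots := by
  classical
  rw [roots_eq, toWt_injective.mem_finset_image]

theorem neg_mem_roots {α : Wt} (h : α ∈ roots) : -α ∈ roots := by
  revert α
  rw [forall_roots]
  intro n hn
  rw [← toWt_neg, toWt_mem_roots]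
  revert n
  decide +kernel

/-- This turns ρ_c and the half sums ρ' into finite integer sums that the kernel evaluates. -/
theorem sum_filter_roots (P : Wt → Prop) [DecidablePred P] (Q : (Fin 4 → ℤ) → Prop)
    [DecidablePred Q] (h : ∀ n ∈ intRoots, P (toWt n) ↔ Q n) :
    ∑ α ∈ roots with P α, α = toWt (∑ n ∈ intRoots with Q n, n) := by
  classical
  rw [toWt_sum, roots_eq, Finset.filter_image, Finset.sum_image toWt_injective.injOn,
    Finset.filter_congr h]

/-- The coefficients of `toWt n` with respect to the simple roots. -/
def simpleCoeff (n : Fin 4 → ℤ) : Fin 4 → ℤ :=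
  ![n 0, (n 3 + n 2 + 3 * n 0 + n 1) / 2, (n 2 + 2 * n 0 + n 1) / 2, (n 0 + n 1) / 2]

-- The simple roots are a basis, so the existential quantifiers in `compactRoots` and `posRoots`
-- become decidable conditions on `simpleCoeff n`.
set_option maxRecDepth 10000 in
theorem toWt_eq_sum_iff {n : Fin 4 → ℤ} (hn : n ∈ intRoots) (c : Fin 4 → ℤ) :
    toWt n = ∑ i, (c i : ℝ) • simpleRoot i ↔ c = simpleCoeff n := by
  -- On roots the integer divisions in `simpleCoeff` are exact.
  have key : 2 * simpleCoeff n 1 = n 3 + n 2 + 3 * n 0 + n 1 ∧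
      2 * simpleCoeff n 2 = n 2 + 2 * n 0 + n 1 ∧ 2 * simpleCoeff n 3 = n 0 + n 1 ∧
      simpleCoeff n 0 = n 0 := by
    revert n
    decide +kernel
  obtain ⟨k1, k2, k3, k0⟩ := key
  rw [simpleSum (fun i => (c i : ℝ))]
  constructor
  · intro h
    have e := congrFun h
    have e0 := e 0
    have e1 := e 1
    have e2 := e 2
    have e3 := e 3
    simp [toWt] at e0 e1 e2 e3
    have f1 : (n 1 : ℝ) = - c 0 + 2 * c 3 := by linarith
    have f2 : (n 2 : ℝ) = - c 0 + 2 * c 2 - 2 * c 3 := by linarith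
    have f3 : (n 3 : ℝ) = - c 0 + 2 * c 1 - 2 * c 2 := by linarith
    norm_cast at e0 f1 f2 f3
    funext i
    fin_cases i <;> simp <;> omega
  · rintro rfl
    have g1 : (2 * simpleCoeff n 1 : ℝ) = n 3 + n 2 + 3 * n 0 + n 1 := by exact_mod_cast k1
    have g2 : (2 * simpleCoeff n 2 : ℝ) = n 2 + 2 * n 0 + n 1 := by exact_mod_cast k2
    have g3 : (2 * simpleCoeff n 3 : ℝ) = n 0 + n 1 := by exact_mod_cast k3
    have g0 : (simpleCoeff n 0 : ℝ) = n 0 := by exact_mod_cast k0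
    funext i
    fin_cases i <;> simp [toWt] <;> linarith

/-! ### Compact roots, ρ_c and dominance for Δ⁺(k, t). -/

theorem toWt_mem_compactRoots {n : Fin 4 → ℤ} :
    toWt n ∈ compactRoots ↔ n ∈ intRoots ∧ Even (simpleCoeff n 3) := by
  classical
  rw [compactRoots, Finset.mem_filter, toWt_mem_roots, and_congr_right_iff]
  intro hn
  simp only [toWt_eq_sum_iff hn, exists_eq_left]

set_option maxRecDepth 10000 in
theorem toWt_mem_posRoots {n : Fin 4 → ℤ} :
    toWt n ∈ posRoots ↔ n ∈ intRoots ∧ ∀ i, 0 ≤ simpleCoeff n i := by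
  classical
  rw [posRoots, Finset.mem_filter, toWt_mem_roots, and_congr_right_iff]
  intro hn
  constructor
  · rintro ⟨c, hc⟩ i
    have := (toWt_eq_sum_iff hn (fun i => (c i : ℤ))).1 (by simpa using hc)
    rw [← this]
    exact Int.natCast_nonneg _
  · intro h
    refine ⟨fun i => (simpleCoeff n i).toNat, ?_⟩
    have := (toWt_eq_sum_iff hn _).2 rfl
    rw [this]
    refine Finset.sum_congr rfl fun i _ => ?_
    congr 1
    exact_mod_cast (Int.toNat_of_nonneg (h i)).symm

theorem toWt_mem_posCompactRoots {n : Fin 4 → ℤ} :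
    toWt n ∈ posCompactRoots ↔
      n ∈ intRoots ∧ Even (simpleCoeff n 3) ∧ ∀ i, 0 ≤ simpleCoeff n i := by
  rw [posCompactRoots, Finset.mem_inter, toWt_mem_compactRoots, toWt_mem_posRoots]
  exact ⟨fun h => ⟨h.1.1, h.1.2, h.2.2⟩, fun h => ⟨⟨h.1, h.2.1⟩, h.1, h.2.2⟩⟩

theorem compactRoots_subset : compactRoots ⊆ roots := by
  classical
  exact Finset.filter_subset _ _

theorem posCompactRoots_subset : posCompactRoots ⊆ roots := by
  classical
  exact Finset.inter_subset_left.trans compactRoots_subset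

theorem forall_posCompactRoots {P : Wt → Prop} : (∀ α ∈ posCompactRoots, P α) ↔
    ∀ n ∈ intRoots, Even (simpleCoeff n 3) ∧ (∀ i, 0 ≤ simpleCoeff n i) → P (toWt n) := by
  constructor
  · intro h n hn hn'
    exact h _ (toWt_mem_posCompactRoots.2 ⟨hn, hn'⟩)
  · intro h α hα
    obtain ⟨n, hn, rfl⟩ : ∃ n ∈ intRoots, toWt n = α := by
      have := posCompactRoots_subset hα
      rwa [roots_eq, Finset.mem_image] at this
    exact h n hn (toWt_mem_posCompactRoots.1 hα).2

set_option maxRecDepth 10000 in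
theorem mem_or_neg_mem_posCompactRoots {α : Wt} (h : α ∈ compactRoots) :
    α ∈ posCompactRoots ∨ -α ∈ posCompactRoots := by
  obtain ⟨n, hn, rfl⟩ : ∃ n ∈ intRoots, toWt n = α := by
    have := compactRoots_subset h
    rwa [roots_eq, Finset.mem_image] at this
  rw [toWt_mem_compactRoots] at h
  rw [← toWt_neg, toWt_mem_posCompactRoots, toWt_mem_posCompactRoots]
  obtain ⟨-, h⟩ := h
  revert n
  decide +kernel

set_option maxRecDepth 10000 in
theorem rhoC_eq : rhoC = toWt ![4, -2, 3, 1] := by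
  classical
  have h : posCompactRoots = roots.filter (· ∈ posCompactRoots) := by
    rw [Finset.filter_mem_eq_inter, Finset.inter_eq_right.2 posCompactRoots_subset]
  rw [rhoC, halfSum, h, sum_filter_roots _
    (fun n => Even (simpleCoeff n 3) ∧ ∀ i, 0 ≤ simpleCoeff n i) fun n hn => by
      rw [toWt_mem_posCompactRoots]; tauto]
  rw [show ∑ n ∈ intRoots with (Even (simpleCoeff n 3) ∧ ∀ i, 0 ≤ simpleCoeff n i), n =
    ![8, -4, 6, 2] by decide +kernel]
  funext i
  fin_cases i <;> norm_num [toWt]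

set_option maxRecDepth 10000 in
theorem rhoC_dotProduct_pos {α : Wt} (h : α ∈ posCompactRoots) : 0 < α ⬝ᵥ rhoC := by
  revert α
  rw [forall_posCompactRoots]
  intro n hn hn'
  rw [rhoC_eq, toWt_dotProduct]
  have : 0 < n ⬝ᵥ ![4, -2, 3, 1] := by
    revert n
    decide +kernel
  positivity

/-- It suffices to test γ₁, …, γ₄. The inequalities are arranged as x₁ - x₂ ≥ x₃ + x₄ ≥ x₃ - x₄ ≥ 0
and x₁ + x₂ ≥ 0, the usual chamber of C₃ × A₁. -/
theorem forall_posCompactRoots_iff (x : Wt) : (∀ α ∈ posCompactRoots, 0 ≤ x ⬝ᵥ α) ↔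
    x 2 + x 3 ≤ x 0 - x 1 ∧ x 2 - x 3 ≤ x 2 + x 3 ∧ 0 ≤ x 2 - x 3 ∧ 0 ≤ x 0 + x 1 := by
  constructor
  · intro h
    have h0 := h _ (compactSimpleRoot_mem 0)
    have h1 := h _ (compactSimpleRoot_mem 1)
    have h2 := h _ (compactSimpleRoot_mem 2)
    have h3 := h _ (compactSimpleRoot_mem 3)
    simp [compactSimpleRoot_eq, dotProduct, Fin.sum_univ_four] at h0 h1 h2 h3
    refine ⟨?_, ?_, ?_, ?_⟩ <;> linarith
  · rintro ⟨h0, h1, h2, h3⟩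
    rw [forall_posCompactRoots]
    intro n hn hn'
    -- Here a, b, c are the coefficients of γ₁, γ₂, γ₃, while d is twice that of γ₄.
    have key : ∃ a b c d : Fin 5, n = ![(a : ℤ) + d, -a + d, -a + 2 * c, -a + 2 * b - 2 * c] := by
      revert n
      decide +kernel
    obtain ⟨a, b, c, d, rfl⟩ := key
    have k0 : (0 : ℝ) ≤ a * (x 0 - x 1 - (x 2 + x 3)) := by
      apply mul_nonneg (by positivity); linarith
    have k1 : (0 : ℝ) ≤ b * (x 3) := by
      apply mul_nonneg (by positivity); linarith
    have k2 : (0 : ℝ) ≤ c * (x 2 - x 3) := by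
      apply mul_nonneg (by positivity); linarith
    have k3 : (0 : ℝ) ≤ d * (x 0 + x 1) := by
      apply mul_nonneg (by positivity); linarith
    simp [dotProduct, Fin.sum_univ_four, toWt]
    linarith

theorem isDominant_iff (Ψ : Finset Wt) (x : Wt) : IsDominant Ψ x ↔ ∀ α ∈ Ψ, 0 ≤ x ⬝ᵥ α := by
  refine forall₂_congr fun α _ => ?_
  rw [pairing]
  have h : 0 ≤ α ⬝ᵥ α := Finset.sum_nonneg fun i _ => mul_self_nonneg _
  rcases h.eq_or_lt with h | h
  -- For α = 0 the pairing is a division by zero, hence 0, and both sides hold.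
  · rw [dotProduct_self_eq_zero.1 h.symm]
    simp
  · rw [div_nonneg_iff]
    constructor
    · rintro (h' | h') <;> linarith
    · intro h'
      exact Or.inl ⟨by positivity, h.le⟩

theorem isDominant_posCompactRoots_iff (x : Wt) : IsDominant posCompactRoots x ↔
    x 2 + x 3 ≤ x 0 - x 1 ∧ x 2 - x 3 ≤ x 2 + x 3 ∧ 0 ≤ x 2 - x 3 ∧ 0 ≤ x 0 + x 1 := by
  rw [isDominant_iff, forall_posCompactRoots_iff]

/-! ### The twelve positive systems containing Δ⁺(k, t). -/

/-- The doubled simple roots of the positive systems containing `Δ⁺(k, t)`, in the order of the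
table. -/
def chamberRoot (x : Fin 12) : Fin 4 → Fin 4 → ℤ :=
  match x with
  | 0 => ![![0, 2, 2, 0], ![0, -2, 0, -2], ![1, 1, -1, 1], ![-1, -1, 1, 1]]
  | 1 => ![![0, -2, -2, 0], ![0, 0, 2, -2], ![1, 1, -1, 1], ![-1, -1, 1, 1]]
  | 2 => ![![0, 0, 2, -2], ![0, 2, 0, 2], ![1, -1, -1, -1], ![-1, -1, 1, 1]]
  | 3 => ![![0, 2, 2, 0], ![2, 0, -2, 0], ![-1, -1, 1, -1], ![0, 0, 0, 2]]
  | 4 => ![![0, 2, 2, 0], ![0, -2, 0, -2], ![0, 0, 0, 2], ![1, 1, -1, -1]]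
  | 5 => ![![0, -2, -2, 0], ![2, 2, 0, 0], ![-1, -1, 1, -1], ![0, 0, 0, 2]]
  | 6 => ![![0, -2, -2, 0], ![0, 0, 2, -2], ![0, 0, 0, 2], ![1, 1, -1, -1]]
  | 7 => ![![0, 0, 2, -2], ![0, 2, 0, 2], ![0, -2, 0, 0], ![1, 1, -1, -1]]
  | 8 => ![![2, 2, 0, 0], ![-2, 0, 2, 0], ![1, -1, -1, -1], ![0, 0, 0, 2]]
  | 9 => ![![0, 0, 2, -2], ![0, -2, 0, 2], ![0, 2, 0, 0], ![1, -1, -1, -1]]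
  | 10 => ![![0, -2, 2, 0], ![0, 2, 0, -2], ![0, 0, 0, 2], ![1, -1, -1, -1]]
  | 11 => ![![0, 2, -2, 0], ![0, 0, 2, -2], ![0, 0, 0, 2], ![1, -1, -1, -1]]

/-- The doubled fundamental weights dual to `chamberRoot`. -/
def chamberWeight (x : Fin 12) : Fin 4 → Fin 4 → ℤ :=
  match x with
  | 0 => ![![2, 0, 2, 0], ![4, -2, 2, 0], ![3, -1, 1, 1], ![1, -1, 1, 1]]
  | 1 => ![![2, -2, 0, 0], ![4, -2, 2, 0], ![3, -1, 1, 1], ![1, -1, 1, 1]]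
  | 2 => ![![2, 0, 2, 0], ![4, 0, 2, 2], ![3, -1, 1, 1], ![1, -1, 1, 1]]
  | 3 => ![![2, 0, 2, 0], ![4, -2, 2, 0], ![2, -2, 2, 0], ![1, -1, 1, 1]]
  | 4 => ![![2, 0, 2, 0], ![4, -2, 2, 0], ![3, -1, 1, 1], ![2, 0, 0, 0]]
  | 5 => ![![2, -2, 0, 0], ![4, -2, 2, 0], ![2, -2, 2, 0], ![1, -1, 1, 1]]
  | 6 => ![![2, -2, 0, 0], ![4, -2, 2, 0], ![3, -1, 1, 1], ![2, 0, 0, 0]]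
  | 7 => ![![2, 0, 2, 0], ![4, 0, 2, 2], ![3, -1, 1, 1], ![2, 0, 0, 0]]
  | 8 => ![![2, 0, 2, 0], ![2, -2, 4, 0], ![2, -2, 2, 0], ![1, -1, 1, 1]]
  | 9 => ![![2, 0, 2, 0], ![4, 0, 2, 2], ![3, 1, 1, 1], ![2, 0, 0, 0]]
  | 10 => ![![2, 0, 2, 0], ![4, 2, 2, 0], ![3, 1, 1, 1], ![2, 0, 0, 0]]
  | 11 => ![![2, 2, 0, 0], ![4, 2, 2, 0], ![3, 1, 1, 1], ![2, 0, 0, 0]]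

/-- The sum of the positive roots. -/
def chamberRho (x : Fin 12) : Fin 4 → ℤ := ∑ k, chamberWeight x k

/-- The positive system with simple roots `chamberRoot x`. -/
noncomputable def chamber (x : Fin 12) : Finset Wt :=
  roots.filter fun α => 0 < α ⬝ᵥ toWt (chamberRho x)

theorem exists_root_eq {α : Wt} (h : α ∈ roots) : ∃ n ∈ intRoots, toWt n = α := by
  classical
  rwa [roots_eq, Finset.mem_image] at h

theorem exists_nat_combination (x : Fin 12) {n : Fin 4 → ℤ} (hn : n ∈ intRoots)
    (h : 0 < n ⬝ᵥ chamberRho x) :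
    ∃ c : Fin 4 → ℕ, n = ∑ k, (c k : ℤ) • chamberRoot x k := by
  -- The product with the k-th fundamental weight is the k-th coefficient times (β, β)/2. Doubling
  -- both vectors multiplies it by 4, which leaves the factor 4 for the long simple roots (k = 0, 1)
  -- and 2 for the short ones.
  refine ⟨fun k => (n ⬝ᵥ chamberWeight x k / if k = 0 ∨ k = 1 then 4 else 2).toNat, ?_⟩
  revert x n
  decide +kernel

theorem dotProduct_chamberRho_ne_zero : ∀ x, ∀ n ∈ intRoots, n ⬝ᵥ chamberRho x ≠ 0 := by
  decide +kernel

theorem toWt_mem_chamber {x : Fin 12} {n : Fin 4 → ℤ} :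
    toWt n ∈ chamber x ↔ n ∈ intRoots ∧ 0 < n ⬝ᵥ chamberRho x := by
  rw [chamber, Finset.mem_filter, toWt_mem_roots, toWt_dotProduct]
  simp

theorem chamberRoot_mem_chamber (x : Fin 12) (k : Fin 4) : toWt (chamberRoot x k) ∈ chamber x := by
  rw [toWt_mem_chamber]
  revert x k
  decide +kernel

theorem chamber_subset (x : Fin 12) : chamber x ⊆ roots := Finset.filter_subset _ _

theorem exists_nonneg_combination {x : Fin 12} {α : Wt} (h : α ∈ chamber x) :
    ∃ c : Fin 4 → ℝ, (∀ k, 0 ≤ c k) ∧ α = ∑ k, c k • toWt (chamberRoot x k) := by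
  obtain ⟨n, hn, rfl⟩ := exists_root_eq (chamber_subset x h)
  obtain ⟨c, hc⟩ := exists_nat_combination x hn (toWt_mem_chamber.1 h).2
  refine ⟨fun k => c k, fun k => Nat.cast_nonneg _, ?_⟩
  conv_lhs => rw [hc, toWt_sum]
  refine Finset.sum_congr rfl fun k _ => ?_
  funext i
  simp [toWt, mul_div_assoc]

theorem dotProduct_chamber_nonneg {x : Fin 12} {v : Wt}
    (h : ∀ k, 0 ≤ v ⬝ᵥ toWt (chamberRoot x k)) {α : Wt} (hα : α ∈ chamber x) : 0 ≤ v ⬝ᵥ α := by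
  obtain ⟨c, hc, rfl⟩ := exists_nonneg_combination hα
  rw [dotProduct_sum]
  refine Finset.sum_nonneg fun k _ => ?_
  rw [dotProduct_smul]
  exact mul_nonneg (hc k) (h k)

theorem isDominant_chamber_iff (x : Fin 12) (v : Wt) :
    IsDominant (chamber x) v ↔ ∀ k, 0 ≤ v ⬝ᵥ toWt (chamberRoot x k) := by
  rw [isDominant_iff]
  exact ⟨fun h k => h _ (chamberRoot_mem_chamber x k), fun h α => dotProduct_chamber_nonneg h⟩

theorem isPositiveSystem_chamber (x : Fin 12) : IsPositiveSystem (chamber x) := by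
  refine ⟨toWt (chamberRho x), ?_, by rw [chamber]⟩
  rw [forall_roots]
  intro n hn
  rw [toWt_dotProduct]
  have := dotProduct_chamberRho_ne_zero x n hn
  simpa using this

theorem halfSum_chamber (x : Fin 12) : halfSum (chamber x) = toWt (chamberRho x) := by
  rw [halfSum, chamber, sum_filter_roots _ (fun n => 0 < n ⬝ᵥ chamberRho x) fun n hn => by
    rw [toWt_dotProduct]; simp]
  rw [show ∑ n ∈ intRoots with 0 < n ⬝ᵥ chamberRho x, n = (2 : ℤ) • chamberRho x by
    revert x; decide +kernel]
  funext i
  simp [toWt]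
  ring

theorem halfSum_chamber_dotProduct_pos {x : Fin 12} {α : Wt} (h : α ∈ chamber x) :
    0 < halfSum (chamber x) ⬝ᵥ α := by
  rw [halfSum_chamber, dotProduct_comm]
  rw [chamber, Finset.mem_filter] at h
  exact h.2

set_option maxRecDepth 10000 in
theorem posCompactRoots_subset_chamber (x : Fin 12) : posCompactRoots ⊆ chamber x := by
  intro α hα
  obtain ⟨n, hn, rfl⟩ := exists_root_eq (posCompactRoots_subset hα)
  obtain ⟨-, h⟩ := toWt_mem_posCompactRoots.1 hα
  refine toWt_mem_chamber.2 ⟨hn, ?_⟩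
  clear hα
  revert x n
  decide +kernel

/-- A regular vector that is dominant for `Δ⁺(k, t)` lies in one of the twelve chambers. -/
theorem exists_chamberRoot_pos {v : Wt} (hv : ∀ α ∈ roots, α ⬝ᵥ v ≠ 0)
    (hc : ∀ α ∈ posCompactRoots, 0 < α ⬝ᵥ v) :
    ∃ x, ∀ k, 0 < toWt (chamberRoot x k) ⬝ᵥ v := by
  have test (n : Fin 4 → ℤ) (hn : n ∈ intRoots) (e : ℝ)
      (he : n 0 * v 0 + n 1 * v 1 + n 2 * v 2 + n 3 * v 3 = e) : 0 < e ∨ e < 0 := by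
    subst he
    rcases (hv _ (toWt_mem_roots.2 hn)).lt_or_gt with h | h <;>
      simp [toWt, dotProduct, Fin.sum_univ_four] at h
    · right; linarith
    · left; linarith
  have leaf (x : Fin 12) (h : ∀ k, 0 < chamberRoot x k 0 * v 0 + chamberRoot x k 1 * v 1 +
      chamberRoot x k 2 * v 2 + chamberRoot x k 3 * v 3) :
      ∃ x, ∀ k, 0 < toWt (chamberRoot x k) ⬝ᵥ v := by
    refine ⟨x, fun k => ?_⟩
    have := h k
    simp [toWt, dotProduct, Fin.sum_univ_four]
    linarith
  have c0 := hc _ (compactSimpleRoot_mem 0)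
  have c1 := hc _ (compactSimpleRoot_mem 1)
  have c2 := hc _ (compactSimpleRoot_mem 2)
  have c3 := hc _ (compactSimpleRoot_mem 3)
  simp [compactSimpleRoot_eq, dotProduct, Fin.sum_univ_four] at c0 c1 c2 c3
  -- The signs of these eight noncompact roots form a decision tree with twelve leaves; at each leaf
  -- they, with γ₁, …, γ₄, force the four simple roots of one chamber to be positive.
  have t0 := test ![1, 1, -1, -1] (by decide +kernel) (v 0 + v 1 - v 2 - v 3) (by simp; ring)
  have t1 := test ![0, 2, 0, 0] (by decide +kernel) (2 * v 1) (by simp)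
  have t2 := test ![0, 2, -2, 0] (by decide +kernel) (2 * v 1 - 2 * v 2) (by simp; ring)
  have t3 := test ![0, 2, 0, -2] (by decide +kernel) (2 * v 1 - 2 * v 3) (by simp; ring)
  have t4 := test ![0, 2, 2, 0] (by decide +kernel) (2 * v 1 + 2 * v 2) (by simp)
  have t5 := test ![0, 2, 0, 2] (by decide +kernel) (2 * v 1 + 2 * v 3) (by simp)
  have t6 := test ![1, 1, -1, 1] (by decide +kernel) (v 0 + v 1 - v 2 + v 3) (by simp; ring)
  have t7 := test ![2, 0, -2, 0] (by decide +kernel) (2 * v 0 - 2 * v 2) (by simp; ring)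
  rcases t0 with h | h
  · rcases t1 with h | h
    · rcases t2 with h | h
      · exact leaf 11 fun k => by fin_cases k <;> simp [chamberRoot] <;> linarith
      · rcases t3 with h | h
        · exact leaf 10 fun k => by fin_cases k <;> simp [chamberRoot] <;> linarith
        · exact leaf 9 fun k => by fin_cases k <;> simp [chamberRoot] <;> linarith
    · rcases t4 with h | h
      · rcases t5 with h | h
        · exact leaf 7 fun k => by fin_cases k <;> simp [chamberRoot] <;> linarith
        · exact leaf 4 fun k => by fin_cases k <;> simp [chamberRoot] <;> linarith
      · exact leaf 6 fun k => by fin_cases k <;> simp [chamberRoot] <;> linarith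
  · rcases t6 with h | h
    · rcases t4 with h | h
      · rcases t5 with h | h
        · exact leaf 2 fun k => by fin_cases k <;> simp [chamberRoot] <;> linarith
        · exact leaf 0 fun k => by fin_cases k <;> simp [chamberRoot] <;> linarith
      · exact leaf 1 fun k => by fin_cases k <;> simp [chamberRoot] <;> linarith
    · rcases t7 with h | h
      · rcases t4 with h | h
        · exact leaf 3 fun k => by fin_cases k <;> simp [chamberRoot] <;> linarith
        · exact leaf 5 fun k => by fin_cases k <;> simp [chamberRoot] <;> linarith
      · exact leaf 8 fun k => by fin_cases k <;> simp [chamberRoot] <;> linarith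

/-- A vector defining Ψ is positive on the simple roots of some chamber, hence nonnegative on all
its roots; of each pair ±α exactly one lies in the chamber, so the two systems coincide. -/
theorem IsPositiveSystem.exists_eq_chamber {Ψ : Finset Wt} (hΨ : IsPositiveSystem Ψ)
    (hc : posCompactRoots ⊆ Ψ) : ∃ x, Ψ = chamber x := by
  classical
  obtain ⟨v, hv, rfl⟩ := hΨ
  obtain ⟨x, hx⟩ := exists_chamberRoot_pos hv fun α hα => (Finset.mem_filter.1 (hc hα)).2
  have hx' : ∀ k, 0 ≤ v ⬝ᵥ toWt (chamberRoot x k) := fun k => by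
    rw [dotProduct_comm]; exact (hx k).le
  refine ⟨x, ?_⟩
  ext α
  rw [Finset.mem_filter]
  constructor
  · rintro ⟨hα, h⟩
    by_contra hn
    obtain ⟨n, hn', rfl⟩ := exists_root_eq hα
    have h1 := dotProduct_chamberRho_ne_zero x n hn'
    have h2 : ¬ 0 < n ⬝ᵥ chamberRho x := fun h => hn (toWt_mem_chamber.2 ⟨hn', h⟩)
    have h3 : toWt (-n) ∈ chamber x := toWt_mem_chamber.2
      ⟨toWt_mem_roots.1 (by rw [toWt_neg]; exact neg_mem_roots hα), by rw [neg_dotProduct]; omega⟩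
    have h4 := dotProduct_chamber_nonneg hx' h3
    rw [toWt_neg, dotProduct_neg, dotProduct_comm] at h4
    linarith
  · intro h
    have hα := chamber_subset x h
    refine ⟨hα, lt_of_le_of_ne ?_ (hv α hα).symm⟩
    rw [dotProduct_comm]
    exact dotProduct_chamber_nonneg hx' h

/-! ### Invariant forms and projection to a chamber. -/

theorem dotProduct_self_pos {x : Wt} (h : x ≠ 0) : 0 < x ⬝ᵥ x :=
  lt_of_le_of_ne (Finset.sum_nonneg fun _ _ => mul_self_nonneg _)
    fun h' => h (dotProduct_self_eq_zero.1 h'.symm)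

theorem ne_zero_of_mem_roots {α : Wt} (h : α ∈ roots) : α ≠ 0 := by
  revert α
  rw [forall_roots]
  intro n hn h
  have h0 : toWt n = toWt 0 := by rw [h]; funext i; simp [toWt]
  have := toWt_injective h0
  subst this
  revert hn
  decide +kernel

/-- The reflections in the eᵢ make the eᵢ orthogonal, and those in e₁ - eᵢ give them equal lengths.
Comparisons of norms therefore reduce to the dot product. -/
theorem IsInvariantForm.exists_eq_smul_dotProduct {B : LinearMap.BilinForm ℝ Wt}
    (hB : IsInvariantForm B) : ∃ c : ℝ, 0 < c ∧ ∀ x y, B x y = c * (x ⬝ᵥ y) := by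
  have refl_single (i j : Fin 4) (hij : i ≠ j) :
      refl (Pi.single i 1) (Pi.single j 1) = Pi.single j 1 := by
    simp [refl, pairing, hij]
  have refl_single_self (i : Fin 4) : refl (Pi.single i 1) (Pi.single i 1) = -Pi.single i 1 := by
    funext k
    simp [refl, pairing]
    ring
  have off (i j : Fin 4) (hij : i ≠ j) : B (Pi.single i 1) (Pi.single j 1) = 0 := by
    have h := hB.invariant (Pi.single i 1) ((mem_roots_iff _).2 (Or.inl ⟨1, i, by simp⟩))
      (Pi.single i 1) (Pi.single j 1)
    rw [refl_single i j hij, refl_single_self, map_neg, LinearMap.neg_apply] at h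
    linarith
  have diag (i : Fin 4) : B (Pi.single i 1) (Pi.single i 1) = B (Pi.single 0 1) (Pi.single 0 1) := by
    rcases eq_or_ne i 0 with rfl | hi
    · rfl
    have hr : (Pi.single 0 1 - Pi.single i 1 : Wt) ∈ roots :=
      (mem_roots_iff _).2 (Or.inr (Or.inl ⟨1, -1, 0, i, Fin.pos_of_ne_zero hi, by
        simp [sub_eq_add_neg]⟩))
    have h := hB.invariant _ hr (Pi.single 0 1) (Pi.single 0 1)
    have hs : refl (Pi.single 0 1 - Pi.single i 1) (Pi.single 0 1) = Pi.single i 1 := by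
      funext k
      simp [refl, pairing, dotProduct_sub, hi, hi.symm]
      ring
    rwa [hs] at h
  refine ⟨B (Pi.single 0 1) (Pi.single 0 1), hB.pos _ (by simp), fun x y => ?_⟩
  conv_lhs => rw [pi_eq_sum_univ' x, pi_eq_sum_univ' y]
  simp only [map_sum, map_smul, LinearMap.sum_apply, LinearMap.smul_apply, smul_eq_mul]
  simp only [dotProduct, Finset.mul_sum]
  refine Finset.sum_congr rfl fun i _ => ?_
  rw [Finset.sum_eq_single i]
  · rw [diag]; ring
  · intro j _ hj
    rw [off _ _ hj]; simp
  · simp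

theorem formNorm_le_iff {B : LinearMap.BilinForm ℝ Wt} (hB : IsInvariantForm B) (x y : Wt) :
    formNorm B x ≤ formNorm B y ↔ x ⬝ᵥ x ≤ y ⬝ᵥ y := by
  obtain ⟨c, hc, h⟩ := hB.exists_eq_smul_dotProduct
  rw [formNorm, formNorm, h, h, Real.sqrt_le_sqrt_iff, mul_le_mul_iff_right₀ hc]
  exact mul_nonneg hc.le (Finset.sum_nonneg fun i _ => mul_self_nonneg _)

theorem isDominant_smul {Ψ : Finset Wt} {x : Wt} (h : IsDominant Ψ x) {t : ℝ} (ht : 0 ≤ t) :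
    IsDominant Ψ (t • x) := by
  rw [isDominant_iff] at h ⊢
  intro α hα
  rw [smul_dotProduct]
  exact mul_nonneg ht (h α hα)

theorem exists_isChamberProjection {B : LinearMap.BilinForm ℝ Wt} (hB : IsInvariantForm B)
    (Ψ : Finset Wt) (x : Wt) : ∃ p, IsChamberProjection B Ψ x p := by
  let s : Set (EuclideanSpace ℝ (Fin 4)) := {q | IsDominant Ψ q.ofLp}
  have hs : IsClosed s := by
    have : s = ⋂ α ∈ Ψ, {q : EuclideanSpace ℝ (Fin 4) | 0 ≤ q.ofLp ⬝ᵥ α} := by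
      ext q
      simp [s, isDominant_iff]
    rw [this]
    refine isClosed_biInter fun α _ => isClosed_le continuous_const ?_
    simp only [dotProduct]
    fun_prop
  have hne : s.Nonempty := ⟨0, fun α _ => by simp [pairing]⟩
  obtain ⟨p, hp, h⟩ := hs.exists_infDist_eq_dist hne (WithLp.toLp 2 x)
  refine ⟨p.ofLp, hp, fun q hq => ?_⟩
  rw [formNorm_le_iff hB]
  have h1 : dist (WithLp.toLp 2 x) p ≤ dist (WithLp.toLp 2 x) (WithLp.toLp 2 q) := by
    rw [← h]
    exact Metric.infDist_le_dist_of_mem hq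
  rw [EuclideanSpace.dist_eq, EuclideanSpace.dist_eq, Real.sqrt_le_sqrt_iff
    (Finset.sum_nonneg fun i _ => sq_nonneg _)] at h1
  simpa [Real.dist_eq, sq_abs, dotProduct, ← sq] using h1

/-- The chamber is a cone, so p competes with all t • p, t ≥ 0. If p·x < p·p, then t = 0 rules out
p·x < 0, and the minimizer t = p·x / p·p beats t = 1. -/
theorem IsChamberProjection.dotProduct_self_le {B : LinearMap.BilinForm ℝ Wt}
    (hB : IsInvariantForm B) {Ψ : Finset Wt} {x p : Wt} (h : IsChamberProjection B Ψ x p) :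
    p ⬝ᵥ p ≤ p ⬝ᵥ x := by
  have key (t : ℝ) (ht : 0 ≤ t) : 0 ≤ (t ^ 2 - 1) * (p ⬝ᵥ p) - 2 * (t - 1) * (p ⬝ᵥ x) := by
    have := (formNorm_le_iff hB _ _).1 (h.2 _ (isDominant_smul h.1 ht))
    simp only [sub_dotProduct, dotProduct_sub, smul_dotProduct, dotProduct_smul, smul_eq_mul,
      dotProduct_comm x p] at this
    linarith
  by_contra! hlt
  have h0 := key 0 le_rfl
  have hp : 0 ≤ p ⬝ᵥ p := Finset.sum_nonneg fun i _ => mul_self_nonneg _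
  have hx : 0 ≤ p ⬝ᵥ x := by linarith
  have hp' : 0 < p ⬝ᵥ p := by linarith
  have h1 := key ((p ⬝ᵥ x) / (p ⬝ᵥ p)) (by positivity)
  have h2 : (((p ⬝ᵥ x) / (p ⬝ᵥ p)) ^ 2 - 1) * (p ⬝ᵥ p) -
      2 * ((p ⬝ᵥ x) / (p ⬝ᵥ p) - 1) * (p ⬝ᵥ x) = - (p ⬝ᵥ p - p ⬝ᵥ x) ^ 2 / (p ⬝ᵥ p) := by
    field_simp
    ring
  rw [h2] at h1
  have : 0 < (p ⬝ᵥ p - p ⬝ᵥ x) ^ 2 / (p ⬝ᵥ p) := by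
    have : 0 < p ⬝ᵥ p - p ⬝ᵥ x := by linarith
    positivity
  rw [neg_div] at h1
  linarith

theorem IsChamberProjection.eq_self {B : LinearMap.BilinForm ℝ Wt}
    (hB : IsInvariantForm B) {Ψ : Finset Wt} {x p : Wt} (h : IsChamberProjection B Ψ x p)
    (hx : IsDominant Ψ x) : p = x := by
  have := (formNorm_le_iff hB _ _).1 (h.2 x hx)
  rw [sub_self, dotProduct_zero] at this
  have h0 : (x - p) ⬝ᵥ (x - p) = 0 :=
    le_antisymm this (Finset.sum_nonneg fun i _ => mul_self_nonneg _)
  exact (sub_eq_zero.1 (dotProduct_self_eq_zero.1 h0)).symm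

/-! ### The Weyl group W(k, t) and the extremal property of dominant weights. -/

theorem refl_dotProduct_refl {α : Wt} (hα : α ≠ 0) (x y : Wt) :
    refl α x ⬝ᵥ refl α y = x ⬝ᵥ y := by
  have := (dotProduct_self_pos hα).ne'
  simp only [refl, pairing, sub_dotProduct, dotProduct_sub, smul_dotProduct, dotProduct_smul,
    smul_eq_mul, dotProduct_comm α y]
  field_simp
  ring

theorem compactWeylGroup_dotProduct {w : Wt ≃ₗ[ℝ] Wt} (hw : w ∈ compactWeylGroup) :
    ∀ x y, w x ⬝ᵥ w y = x ⬝ᵥ y := by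
  induction hw using Subgroup.closure_induction with
  | mem w h =>
    obtain ⟨α, hα, hw⟩ := h
    intro x y
    rw [hw, hw, refl_dotProduct_refl (ne_zero_of_mem_roots (compactRoots_subset hα))]
  | one => intro x y; rfl
  | mul v w _ _ hv hw => intro x y; rw [LinearEquiv.mul_apply, LinearEquiv.mul_apply, hv, hw]
  | inv w _ hw =>
    intro x y
    rw [← hw]
    simp

theorem exists_mem_compactWeylGroup {α : Wt} (hα : α ∈ compactRoots) :
    ∃ w ∈ compactWeylGroup, ∀ x, w x = refl α x := by
  have h0 := (dotProduct_self_pos (ne_zero_of_mem_roots (compactRoots_subset hα))).ne'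
  let f : Module.Dual ℝ Wt :=
    { toFun := fun x => pairing x α
      map_add' := fun x y => by
        simp only [pairing, add_dotProduct]
        ring
      map_smul' := fun c x => by
        change pairing (c • x) α = c * pairing x α
        rw [pairing, pairing, smul_dotProduct, smul_eq_mul]
        ring }
  have hf : f α = 2 := by
    change pairing α α = 2
    rw [pairing]; field_simp
  have h (x : Wt) : Module.reflection hf x = refl α x := by
    rw [Module.reflection_apply]; rfl
  exact ⟨Module.reflection hf, Subgroup.subset_closure ⟨α, hα, h⟩, h⟩

/-- The weight with given values of `x₁ - x₂`, `x₃ + x₄`, `x₃ - x₄` and `x₁ + x₂`. -/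
noncomputable def ofOrtho (a b c d : ℝ) : Wt := ![(a + d) / 2, (d - a) / 2, (b + c) / 2, (b - c) / 2]

theorem exists_eq_ofOrtho (x : Wt) :
    x = ofOrtho (x 0 - x 1) (x 2 + x 3) (x 2 - x 3) (x 0 + x 1) := by
  funext i
  fin_cases i <;> simp [ofOrtho]

theorem isDominant_ofOrtho_iff (a b c d : ℝ) : IsDominant posCompactRoots (ofOrtho a b c d) ↔
    b ≤ a ∧ c ≤ b ∧ 0 ≤ c ∧ 0 ≤ d := by
  rw [isDominant_posCompactRoots_iff]
  simp only [ofOrtho, Matrix.cons_val]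
  ring_nf

/-- The ten positive compact roots: W(C₃) acts by signed permutations of a, b, c and W(A₁) by the
sign of d. -/
theorem refl_ofOrtho (a b c d : ℝ) :
    refl (toWt ![2, -2, 0, 0]) (ofOrtho a b c d) = ofOrtho (-a) b c d ∧
    refl (toWt ![0, 0, 2, 2]) (ofOrtho a b c d) = ofOrtho a (-b) c d ∧
    refl (toWt ![0, 0, 2, -2]) (ofOrtho a b c d) = ofOrtho a b (-c) d ∧
    refl (toWt ![2, 2, 0, 0]) (ofOrtho a b c d) = ofOrtho a b c (-d) ∧
    refl (toWt ![1, -1, -1, -1]) (ofOrtho a b c d) = ofOrtho b a c d ∧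
    refl (toWt ![1, -1, 1, 1]) (ofOrtho a b c d) = ofOrtho (-b) (-a) c d ∧
    refl (toWt ![1, -1, -1, 1]) (ofOrtho a b c d) = ofOrtho c b a d ∧
    refl (toWt ![1, -1, 1, -1]) (ofOrtho a b c d) = ofOrtho (-c) b (-a) d ∧
    refl (toWt ![0, 0, 0, 2]) (ofOrtho a b c d) = ofOrtho a c b d ∧
    refl (toWt ![0, 0, 2, 0]) (ofOrtho a b c d) = ofOrtho a (-c) (-b) d := by
  refine ⟨?_, ?_, ?_, ?_, ?_, ?_, ?_, ?_, ?_, ?_⟩ <;> funext i <;> fin_cases i <;>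
    simp [refl, pairing, ofOrtho, toWt, dotProduct, Fin.sum_univ_four] <;> ring

theorem exists_isDominant_of_refl {α : Wt} (hα : α ∈ compactRoots) {x y : Wt} (hxy : refl α x = y)
    (h : ∃ w ∈ compactWeylGroup, IsDominant posCompactRoots (w y)) :
    ∃ w ∈ compactWeylGroup, IsDominant posCompactRoots (w x) := by
  obtain ⟨w, hw, hd⟩ := h
  obtain ⟨v, hv, hv'⟩ := exists_mem_compactWeylGroup hα
  exact ⟨w * v, mul_mem hw hv, by rwa [LinearEquiv.mul_apply, hv', hxy]⟩

/-- Every weight is conjugate under `W(k, t)` to a dominant one. -/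
theorem exists_isDominant (x : Wt) :
    ∃ w ∈ compactWeylGroup, IsDominant posCompactRoots (w x) := by
  have mem (n : Fin 4 → ℤ) (h : n ∈ intRoots ∧ Even (simpleCoeff n 3)) : toWt n ∈ compactRoots :=
    toWt_mem_compactRoots.2 h
  let Q (a b c d : ℝ) : Prop :=
    ∃ w ∈ compactWeylGroup, IsDominant posCompactRoots (w (ofOrtho a b c d))
  have base {a b c d} (h1 : b ≤ a) (h2 : c ≤ b) (h3 : 0 ≤ c) (h4 : 0 ≤ d) : Q a b c d :=
    ⟨1, one_mem _, (isDominant_ofOrtho_iff a b c d).2 ⟨h1, h2, h3, h4⟩⟩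
  have flipA {a b c d} : Q (-a) b c d → Q a b c d :=
    exists_isDominant_of_refl (mem ![2, -2, 0, 0] (by decide +kernel)) (refl_ofOrtho a b c d).1
  have flipB {a b c d} : Q a (-b) c d → Q a b c d :=
    exists_isDominant_of_refl (mem ![0, 0, 2, 2] (by decide +kernel)) (refl_ofOrtho a b c d).2.1
  have flipC {a b c d} : Q a b (-c) d → Q a b c d :=
    exists_isDominant_of_refl (mem ![0, 0, 2, -2] (by decide +kernel)) (refl_ofOrtho a b c d).2.2.1
  have flipD {a b c d} : Q a b c (-d) → Q a b c d :=
    exists_isDominant_of_refl (mem ![2, 2, 0, 0] (by decide +kernel)) (refl_ofOrtho a b c d).2.2.2.1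
  have swapAB {a b c d} : Q b a c d → Q a b c d :=
    exists_isDominant_of_refl (mem ![1, -1, -1, -1] (by decide +kernel))
      (refl_ofOrtho a b c d).2.2.2.2.1
  have swapBC {a b c d} : Q a c b d → Q a b c d :=
    exists_isDominant_of_refl (mem ![0, 0, 0, 2] (by decide +kernel))
      (refl_ofOrtho a b c d).2.2.2.2.2.2.2.2.1
  have sort {a b c d} (ha : 0 ≤ a) (hb : 0 ≤ b) (hc : 0 ≤ c) (hd : 0 ≤ d) : Q a b c d := by
    rcases le_total a b with h1 | h1 <;> rcases le_total b c with h2 | h2 <;>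
      rcases le_total a c with h3 | h3
    · exact swapAB (swapBC (swapAB (base h2 h1 ha hd)))
    · exact swapAB (swapBC (swapAB (base h2 h1 ha hd)))
    · exact swapAB (swapBC (base h2 h3 ha hd))
    · exact swapAB (base h1 h3 hc hd)
    · exact swapBC (swapAB (base h3 h1 hb hd))
    · exact swapBC (base h3 h2 hb hd)
    · exact base h1 h2 hc hd
    · exact base h1 h2 hc hd
  have pos (a b c d : ℝ) : Q a b c d := by
    have hA : Q |a| b c d → Q a b c d := by
      rcases abs_choice a with h | h <;> rw [h]
      exacts [id, flipA]
    have hB : Q |a| |b| c d → Q |a| b c d := by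
      rcases abs_choice b with h | h <;> rw [h]
      exacts [id, flipB]
    have hC : Q |a| |b| |c| d → Q |a| |b| c d := by
      rcases abs_choice c with h | h <;> rw [h]
      exacts [id, flipC]
    have hD : Q |a| |b| |c| |d| → Q |a| |b| |c| d := by
      rcases abs_choice d with h | h <;> rw [h]
      exacts [id, flipD]
    exact hA (hB (hC (hD (sort (abs_nonneg a) (abs_nonneg b) (abs_nonneg c) (abs_nonneg d)))))
  rw [exists_eq_ofOrtho x]
  exact pos _ _ _ _

/-- The absolute values of the coordinates in which the Weyl group of the factor `C₃` acts by signed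
permutations. -/
noncomputable def absOrtho (x : Wt) : Fin 3 → ℝ := ![|x 0 - x 1|, |x 2 + x 3|, |x 2 - x 3|]

theorem absOrtho_ofOrtho (a b c d : ℝ) : absOrtho (ofOrtho a b c d) = ![|a|, |b|, |c|] := by
  simp only [absOrtho, ofOrtho, Matrix.cons_val]
  ring_nf

theorem abs_add_ofOrtho (a b c d : ℝ) : |ofOrtho a b c d 0 + ofOrtho a b c d 1| = |d| := by
  simp only [ofOrtho, Matrix.cons_val]
  ring_nf

theorem refl_neg (α x : Wt) : refl (-α) x = refl α x := by
  simp only [refl, pairing, dotProduct_neg, neg_dotProduct, neg_neg, smul_neg]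
  rw [mul_neg, neg_div, neg_smul, neg_neg]

theorem exists_perm_absOrtho_refl {α : Wt} (hα : α ∈ compactRoots) (x : Wt) :
    (∃ σ : Equiv.Perm (Fin 3), absOrtho (refl α x) = absOrtho x ∘ σ) ∧
      |refl α x 0 + refl α x 1| = |x 0 + x 1| := by
  wlog hp : α ∈ posCompactRoots generalizing α
  · have h := (mem_or_neg_mem_posCompactRoots hα).resolve_left hp
    rw [← refl_neg]
    exact this (by classical exact Finset.inter_subset_left h) h
  obtain ⟨n, hn, rfl⟩ := exists_root_eq (compactRoots_subset hα)
  obtain ⟨-, h⟩ := toWt_mem_posCompactRoots.1 hp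
  have hcases : n = ![2, -2, 0, 0] ∨ n = ![0, 0, 2, 2] ∨ n = ![0, 0, 2, -2] ∨ n = ![2, 2, 0, 0] ∨
      n = ![1, -1, -1, -1] ∨ n = ![1, -1, 1, 1] ∨ n = ![1, -1, -1, 1] ∨ n = ![1, -1, 1, -1] ∨
      n = ![0, 0, 0, 2] ∨ n = ![0, 0, 2, 0] := by
    clear hα hp
    revert n
    decide +kernel
  rw [exists_eq_ofOrtho x]
  generalize x 0 - x 1 = a, x 2 + x 3 = b, x 2 - x 3 = c, x 0 + x 1 = d
  obtain ⟨r1, r2, r3, r4, r5, r6, r7, r8, r9, r10⟩ := refl_ofOrtho a b c d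
  have id3 (f : Fin 3 → ℝ) : f = f ∘ (1 : Equiv.Perm (Fin 3)) := rfl
  have s01 (f : Fin 3 → ℝ) : ![f 1, f 0, f 2] = f ∘ Equiv.swap 0 1 := by
    funext i; fin_cases i <;> rfl
  have s02 (f : Fin 3 → ℝ) : ![f 2, f 1, f 0] = f ∘ Equiv.swap 0 2 := by
    funext i; fin_cases i <;> rfl
  have s12 (f : Fin 3 → ℝ) : ![f 0, f 2, f 1] = f ∘ Equiv.swap 1 2 := by
    funext i; fin_cases i <;> rfl
  rcases hcases with rfl | rfl | rfl | rfl | rfl | rfl | rfl | rfl | rfl | rfl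
  · rw [r1, abs_add_ofOrtho, abs_add_ofOrtho, absOrtho_ofOrtho, absOrtho_ofOrtho, abs_neg]
    exact ⟨⟨1, id3 _⟩, rfl⟩
  · rw [r2, abs_add_ofOrtho, abs_add_ofOrtho, absOrtho_ofOrtho, absOrtho_ofOrtho, abs_neg]
    exact ⟨⟨1, id3 _⟩, rfl⟩
  · rw [r3, abs_add_ofOrtho, abs_add_ofOrtho, absOrtho_ofOrtho, absOrtho_ofOrtho, abs_neg]
    exact ⟨⟨1, id3 _⟩, rfl⟩
  · rw [r4, abs_add_ofOrtho, abs_add_ofOrtho, absOrtho_ofOrtho, absOrtho_ofOrtho, abs_neg]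
    exact ⟨⟨1, id3 _⟩, rfl⟩
  · rw [r5, abs_add_ofOrtho, abs_add_ofOrtho, absOrtho_ofOrtho, absOrtho_ofOrtho]
    exact ⟨⟨_, s01 ![|a|, |b|, |c|]⟩, rfl⟩
  · rw [r6, abs_add_ofOrtho, abs_add_ofOrtho, absOrtho_ofOrtho, absOrtho_ofOrtho, abs_neg, abs_neg]
    exact ⟨⟨_, s01 ![|a|, |b|, |c|]⟩, rfl⟩
  · rw [r7, abs_add_ofOrtho, abs_add_ofOrtho, absOrtho_ofOrtho, absOrtho_ofOrtho]
    exact ⟨⟨_, s02 ![|a|, |b|, |c|]⟩, rfl⟩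
  · rw [r8, abs_add_ofOrtho, abs_add_ofOrtho, absOrtho_ofOrtho, absOrtho_ofOrtho, abs_neg, abs_neg]
    exact ⟨⟨_, s02 ![|a|, |b|, |c|]⟩, rfl⟩
  · rw [r9, abs_add_ofOrtho, abs_add_ofOrtho, absOrtho_ofOrtho, absOrtho_ofOrtho]
    exact ⟨⟨_, s12 ![|a|, |b|, |c|]⟩, rfl⟩
  · rw [r10, abs_add_ofOrtho, abs_add_ofOrtho, absOrtho_ofOrtho, absOrtho_ofOrtho, abs_neg, abs_neg]
    exact ⟨⟨_, s12 ![|a|, |b|, |c|]⟩, rfl⟩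

/-- These invariants of an orbit replace an explicit description of the group W(k, t). -/
theorem exists_perm_absOrtho {w : Wt ≃ₗ[ℝ] Wt} (hw : w ∈ compactWeylGroup) (x : Wt) :
    (∃ σ : Equiv.Perm (Fin 3), absOrtho (w x) = absOrtho x ∘ σ) ∧
      |w x 0 + w x 1| = |x 0 + x 1| := by
  induction hw using Subgroup.closure_induction generalizing x with
  | mem w h =>
    obtain ⟨α, hα, hw⟩ := h
    rw [hw]
    exact exists_perm_absOrtho_refl hα x
  | one => exact ⟨⟨1, rfl⟩, rfl⟩
  | mul v w _ _ hv hw =>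
    obtain ⟨⟨σ, hσ⟩, h⟩ := hv (w x)
    obtain ⟨⟨τ, hτ⟩, h'⟩ := hw x
    rw [LinearEquiv.mul_apply]
    refine ⟨⟨τ * σ, ?_⟩, h.trans h'⟩
    rw [hσ, hτ]
    rfl
  | inv w _ hw =>
    obtain ⟨⟨σ, hσ⟩, h⟩ := hw (w⁻¹ x)
    have hx : w (w⁻¹ x) = x := by simp
    rw [hx] at hσ h
    refine ⟨⟨σ⁻¹, ?_⟩, h.symm⟩
    rw [hσ]
    funext i
    simp

/-- The dominant weight of a `W(k, t)`-orbit has the largest product with `ρ_c`. -/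
theorem dotProduct_rhoC_le {w : Wt ≃ₗ[ℝ] Wt} (hw : w ∈ compactWeylGroup) {x : Wt}
    (h : IsDominant posCompactRoots (w x)) : x ⬝ᵥ rhoC ≤ w x ⬝ᵥ rhoC := by
  obtain ⟨⟨σ, hσ⟩, hz⟩ := exists_perm_absOrtho hw x
  have hσ' : absOrtho x = absOrtho (w x) ∘ (σ⁻¹ : Equiv.Perm (Fin 3)) := by
    rw [hσ]; funext i; simp
  generalize w x = y at *
  rw [isDominant_posCompactRoots_iff] at h
  obtain ⟨h1, h2, h3, h4⟩ := h
  -- Rearrangement inequality: ρ_c is `ofOrtho 3 2 1 1`, and a dominant y has decreasing nonnegative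
  -- C₃-coordinates.
  have key : ∑ i, absOrtho y (σ⁻¹ i) * (![3, 2, 1] : Fin 3 → ℝ) i ≤
      ∑ i, absOrtho y i * (![3, 2, 1] : Fin 3 → ℝ) i := by
    refine Monovary.sum_comp_perm_mul_le_sum_mul (Antitone.monovary ?_ ?_)
    · rw [Fin.antitone_iff_succ_le]
      intro i
      have e0 : |y 0 - y 1| = y 0 - y 1 := abs_of_nonneg (by linarith)
      have e1 : |y 2 + y 3| = y 2 + y 3 := abs_of_nonneg (by linarith)
      have e2 : |y 2 - y 3| = y 2 - y 3 := abs_of_nonneg (by linarith)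
      fin_cases i <;> simp [absOrtho, e0, e1, e2] <;> linarith
    · rw [Fin.antitone_iff_succ_le]
      intro i
      fin_cases i
      · norm_num
      · change (1 : ℝ) ≤ 2
        norm_num
  have key' : ∑ i, absOrtho x i * (![3, 2, 1] : Fin 3 → ℝ) i ≤
      ∑ i, absOrtho y i * (![3, 2, 1] : Fin 3 → ℝ) i := by
    rw [hσ']; exact key
  have e0 : |y 0 - y 1| = y 0 - y 1 := abs_of_nonneg (by linarith)
  have e1 : |y 2 + y 3| = y 2 + y 3 := abs_of_nonneg (by linarith)
  have e2 : |y 2 - y 3| = y 2 - y 3 := abs_of_nonneg (by linarith)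
  have e3 : |y 0 + y 1| = y 0 + y 1 := abs_of_nonneg h4
  simp [Fin.sum_univ_three, absOrtho, e0, e1, e2] at key'
  have a0 := le_abs_self (x 0 - x 1)
  have a1 := le_abs_self (x 2 + x 3)
  have a2 := le_abs_self (x 2 - x 3)
  have a3 := le_abs_self (x 0 + x 1)
  rw [rhoC_eq]
  simp [dotProduct, Fin.sum_univ_four, toWt]
  linarith

theorem isDominant_of_compactSimpleRoot {x : Wt}
    (h : ∀ j, 0 ≤ x ⬝ᵥ compactSimpleRoot j) : IsDominant posCompactRoots x := by
  rw [isDominant_posCompactRoots_iff]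
  have h0 := h 0
  have h1 := h 1
  have h2 := h 2
  have h3 := h 3
  simp [compactSimpleRoot_eq, dotProduct, Fin.sum_univ_four] at h0 h1 h2 h3
  refine ⟨?_, ?_, ?_, ?_⟩ <;> linarith

/-- If x were negative on some γⱼ, reflecting it in γⱼ would strictly increase the product with ρ_c
beyond the maximum over the orbit. -/
theorem isDominant_of_dotProduct_rhoC_eq {w : Wt ≃ₗ[ℝ] Wt} (hw : w ∈ compactWeylGroup) {x : Wt}
    (h : IsDominant posCompactRoots (w x)) (he : w x ⬝ᵥ rhoC ≤ x ⬝ᵥ rhoC) :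
    IsDominant posCompactRoots x := by
  refine isDominant_of_compactSimpleRoot fun j => ?_
  by_contra! hlt
  have hj := compactSimpleRoot_mem j
  have hj' : compactSimpleRoot j ∈ compactRoots := by classical exact Finset.inter_subset_left hj
  obtain ⟨v, hv, hv'⟩ := exists_mem_compactWeylGroup hj'
  have h1 : (w * v⁻¹) (refl (compactSimpleRoot j) x) = w x := by
    rw [← hv', LinearEquiv.mul_apply]; simp
  have h2 := dotProduct_rhoC_le (mul_mem hw (inv_mem hv)) (h1.symm ▸ h)
  rw [h1, refl, sub_dotProduct, smul_dotProduct, smul_eq_mul] at h2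
  have h3 := rhoC_dotProduct_pos hj
  have h4 : pairing x (compactSimpleRoot j) < 0 :=
    div_neg_of_neg_of_pos (by linarith)
      (dotProduct_self_pos (ne_zero_of_mem_roots (compactRoots_subset hj')))
  nlinarith

/-- This much of the uniqueness of the dominant conjugate {ν} already makes ‖{ν} + ρ_c‖ well
defined. -/
theorem dotProduct_rhoC_eq {v w : Wt ≃ₗ[ℝ] Wt} (hv : v ∈ compactWeylGroup)
    (hw : w ∈ compactWeylGroup) {x : Wt} (h : IsDominant posCompactRoots (v x))
    (h' : IsDominant posCompactRoots (w x)) : v x ⬝ᵥ rhoC = w x ⬝ᵥ rhoC := by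
  have key {v w : Wt ≃ₗ[ℝ] Wt} (hv : v ∈ compactWeylGroup) (hw : w ∈ compactWeylGroup)
      (h : IsDominant posCompactRoots (w x)) : v x ⬝ᵥ rhoC ≤ w x ⬝ᵥ rhoC := by
    have e : (w * v⁻¹) (v x) = w x := by rw [LinearEquiv.mul_apply]; simp
    have := dotProduct_rhoC_le (mul_mem hw (inv_mem hv)) (e.symm ▸ h)
    rwa [e] at this
  exact le_antisymm (key hv hw h') (key hw hv h)

/-! ### Positive systems and their half sums. -/

theorem IsPositiveSystem.subset_roots {Ψ : Finset Wt} (h : IsPositiveSystem Ψ) : Ψ ⊆ roots := by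
  classical
  obtain ⟨v, -, rfl⟩ := h
  exact Finset.filter_subset _ _

theorem IsPositiveSystem.neg_mem_iff {Ψ : Finset Wt} (h : IsPositiveSystem Ψ) {α : Wt}
    (hα : α ∈ roots) : -α ∈ Ψ ↔ α ∉ Ψ := by
  classical
  obtain ⟨v, hv, rfl⟩ := h
  have := hv α hα
  simp only [Finset.mem_filter, hα, neg_mem_roots hα, true_and, neg_dotProduct, Left.neg_pos_iff,
    not_lt]
  exact ⟨fun h => h.le, fun h => lt_of_le_of_ne h this⟩

-- The roots of Ψ' \ Ψ are the negatives of those of Ψ \ Ψ', and the common roots cancel.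
open Classical in
theorem halfSum_sub_halfSum {Ψ Ψ' : Finset Wt} (h : IsPositiveSystem Ψ)
    (h' : IsPositiveSystem Ψ') : halfSum Ψ - halfSum Ψ' = ∑ α ∈ Ψ \ Ψ', α := by
  have e : ∑ α ∈ Ψ' \ Ψ, α = -∑ α ∈ Ψ \ Ψ', α := by
    rw [← Finset.sum_neg_distrib]
    refine Finset.sum_nbij' (fun α => -α) (fun α => -α) ?_ ?_ (fun _ _ => neg_neg _)
      (fun _ _ => neg_neg _) (fun _ _ => (neg_neg _).symm)
    · intro α hα
      obtain ⟨h1, h2⟩ := Finset.mem_sdiff.1 hα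
      have hr := h'.subset_roots h1
      rw [Finset.mem_sdiff, h.neg_mem_iff hr, h'.neg_mem_iff hr]
      exact ⟨h2, not_not.2 h1⟩
    · intro α hα
      obtain ⟨h1, h2⟩ := Finset.mem_sdiff.1 hα
      have hr := h.subset_roots h1
      rw [Finset.mem_sdiff, h.neg_mem_iff hr, h'.neg_mem_iff hr]
      exact ⟨h2, not_not.2 h1⟩
  rw [halfSum, halfSum, ← Finset.sum_inter_add_sum_sdiff Ψ Ψ', ← Finset.sum_inter_add_sum_sdiff Ψ' Ψ, e,
    Finset.inter_comm Ψ' Ψ]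
  module

open Classical in
theorem halfSum_inter_noncompactRoots {Ψ : Finset Wt} (h : IsPositiveSystem Ψ)
    (hc : posCompactRoots ⊆ Ψ) : halfSum (Ψ ∩ noncompactRoots) = halfSum Ψ - rhoC := by
  have e : Ψ ∩ noncompactRoots = Ψ \ posCompactRoots := by
    ext α
    simp only [noncompactRoots, Finset.mem_inter, Finset.mem_sdiff]
    constructor
    · rintro ⟨h1, -, h3⟩
      exact ⟨h1, fun h4 => h3 (Finset.mem_inter.1 h4).1⟩
    · rintro ⟨h1, h2⟩
      refine ⟨h1, h.subset_roots h1, fun h3 => ?_⟩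
      have h4 := hc ((mem_or_neg_mem_posCompactRoots h3).resolve_left h2)
      exact (h.neg_mem_iff (h.subset_roots h1)).1 h4 h1
  rw [e, rhoC, halfSum, halfSum, halfSum, ← Finset.sum_sdiff hc]
  module

/-- For a regular vector u and small t > 0, x + t • u is regular, and every root positive on it is
nonnegative on x. -/
theorem exists_isPositiveSystem_isDominant (x : Wt) :
    ∃ Ψ, IsPositiveSystem Ψ ∧ IsDominant Ψ x := by
  classical
  obtain ⟨u, hu, -⟩ := isPositiveSystem_chamber 0
  have key (α : Wt) (hα : α ∈ roots) : ∀ᶠ t : ℝ in nhdsWithin 0 (Set.Ioi 0),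
      α ⬝ᵥ (x + t • u) ≠ 0 ∧ (0 < α ⬝ᵥ (x + t • u) → 0 ≤ x ⬝ᵥ α) := by
    have hc : Filter.Tendsto (fun t : ℝ => α ⬝ᵥ (x + t • u)) (nhdsWithin 0 (Set.Ioi 0))
        (nhds (α ⬝ᵥ x)) := by
      have : Continuous fun t : ℝ => α ⬝ᵥ x + t * (α ⬝ᵥ u) := by fun_prop
      have := (this.tendsto 0).mono_left (nhdsWithin_le_nhds (s := Set.Ioi 0))
      simpa [dotProduct_add, dotProduct_smul] using this
    rcases lt_trichotomy (α ⬝ᵥ x) 0 with h | h | h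
    · filter_upwards [hc.eventually (gt_mem_nhds h)] with t ht
      exact ⟨ht.ne, fun h' => absurd h' ht.not_gt⟩
    · filter_upwards [self_mem_nhdsWithin] with t ht
      rw [dotProduct_add, dotProduct_smul, h, zero_add, dotProduct_comm x, h]
      exact ⟨mul_ne_zero (ne_of_gt ht) (hu α hα), fun _ => le_rfl⟩
    · filter_upwards [hc.eventually (lt_mem_nhds h)] with t ht
      rw [dotProduct_comm x]
      exact ⟨ht.ne', fun _ => h.le⟩
  obtain ⟨t, ht⟩ := ((Filter.eventually_all_finset roots).2 key).exists
  refine ⟨roots.filter fun α => 0 < α ⬝ᵥ (x + t • u), ⟨x + t • u, fun α hα => (ht α hα).1, ?_⟩, ?_⟩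
  · congr
  · rw [isDominant_iff]
    intro α hα
    obtain ⟨h1, h2⟩ := Finset.mem_filter.1 hα
    exact (ht α h1).2 h2

/-! ### Comparison of the spin norm with the lambda norm. -/

open Classical in
/-- Every value defining the spin norm is at least every value defining the lambda norm. In the case
of equality the projections defining these values are trivial. -/
theorem lambda_le_spin {B : LinearMap.BilinForm ℝ Wt} (hB : IsInvariantForm B) {μ p : Wt}
    {Ψ Ψ' : Finset Wt} (h : IsPositiveSystem Ψ) (h' : IsPositiveSystem Ψ')
    (hc' : posCompactRoots ⊆ Ψ')
    (hp : IsChamberProjection B Ψ (μ + (2 : ℝ) • rhoC - halfSum Ψ) p)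
    {w : Wt ≃ₗ[ℝ] Wt} (hw : w ∈ compactWeylGroup)
    (hd : IsDominant posCompactRoots (w (μ - halfSum (Ψ' ∩ noncompactRoots)))) :
    p ⬝ᵥ p ≤ (w (μ - halfSum (Ψ' ∩ noncompactRoots)) + rhoC) ⬝ᵥ
        (w (μ - halfSum (Ψ' ∩ noncompactRoots)) + rhoC) ∧
      ((w (μ - halfSum (Ψ' ∩ noncompactRoots)) + rhoC) ⬝ᵥ
        (w (μ - halfSum (Ψ' ∩ noncompactRoots)) + rhoC) ≤ p ⬝ᵥ p →
        IsDominant Ψ' (μ + (2 : ℝ) • rhoC - halfSum Ψ') ∧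
        IsDominant posCompactRoots (μ + rhoC - halfSum Ψ')) := by
  have hx : μ - halfSum (Ψ' ∩ noncompactRoots) = μ + rhoC - halfSum Ψ' := by
    rw [halfSum_inter_noncompactRoots h' hc']; abel
  rw [hx] at hd ⊢
  set x := μ + rhoC - halfSum Ψ' with hxdef
  have hs : x + rhoC = (μ + (2 : ℝ) • rhoC - halfSum Ψ) + ∑ α ∈ Ψ \ Ψ', α := by
    rw [← halfSum_sub_halfSum h h', hxdef]
    module
  have hx2 : μ + (2 : ℝ) • rhoC - halfSum Ψ' = x + rhoC := by
    rw [hxdef]; module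
  have hpη := hp.dotProduct_self_le hB
  have hpα : ∀ α ∈ Ψ \ Ψ', 0 ≤ p ⬝ᵥ α := fun α hα =>
    (isDominant_iff _ _).1 hp.1 α (Finset.mem_sdiff.1 hα).1
  have hps : 0 ≤ ∑ α ∈ Ψ \ Ψ', p ⬝ᵥ α := Finset.sum_nonneg hpα
  have hpx : p ⬝ᵥ (x + rhoC) = p ⬝ᵥ (μ + (2 : ℝ) • rhoC - halfSum Ψ) + ∑ α ∈ Ψ \ Ψ', p ⬝ᵥ α := by
    rw [hs, dotProduct_add, dotProduct_sum]
  have hsq : (x + rhoC - p) ⬝ᵥ (x + rhoC - p) =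
      (x + rhoC) ⬝ᵥ (x + rhoC) - 2 * (p ⬝ᵥ (x + rhoC)) + p ⬝ᵥ p := by
    rw [sub_dotProduct, dotProduct_sub, dotProduct_sub, dotProduct_comm (x + rhoC) p]
    ring
  have hsq0 : 0 ≤ (x + rhoC - p) ⬝ᵥ (x + rhoC - p) :=
    Finset.sum_nonneg fun _ _ => mul_self_nonneg _
  have hρ := dotProduct_rhoC_le hw hd
  have hν : (w x + rhoC) ⬝ᵥ (w x + rhoC) =
      (x + rhoC) ⬝ᵥ (x + rhoC) + 2 * (w x ⬝ᵥ rhoC - x ⬝ᵥ rhoC) := by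
    have := compactWeylGroup_dotProduct hw x x
    simp only [add_dotProduct, dotProduct_add, this, dotProduct_comm rhoC]
    ring
  -- With ν = w x, the difference |ν + ρ_c|² - |p|² equals |x + ρ_c - p|² + 2(p·(x + ρ_c) - p·p) +
  -- 2(ν·ρ_c - x·ρ_c), a sum of nonnegative terms. In the case of equality each of them vanishes.
  refine ⟨by linarith, fun hle => ?_⟩
  have hxp : x + rhoC = p := by
    refine sub_eq_zero.1 (dotProduct_self_eq_zero.1 (le_antisymm ?_ hsq0))
    linarith
  have hzero : ∀ α ∈ Ψ \ Ψ', p ⬝ᵥ α = 0 := by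
    refine (Finset.sum_eq_zero_iff_of_nonneg hpα).1 (le_antisymm ?_ hps)
    rw [hxp] at hpx
    linarith
  refine ⟨?_, isDominant_of_dotProduct_rhoC_eq hw hd ?_⟩
  · rw [hx2, hxp, isDominant_iff]
    intro α hα
    by_cases hα' : α ∈ Ψ
    · exact (isDominant_iff _ _).1 hp.1 α hα'
    -- Here -α lies in Ψ \ Ψ', on which p vanishes.
    · have hr := h'.subset_roots hα
      have h1 := (h.neg_mem_iff hr).2 hα'
      have h2 : -α ∉ Ψ' := fun h3 => (h'.neg_mem_iff hr).1 h3 hα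
      have := hzero _ (Finset.mem_sdiff.2 ⟨h1, h2⟩)
      rw [dotProduct_neg] at this
      linarith
  · linarith

theorem formNorm_nonneg (B : LinearMap.BilinForm ℝ Wt) (x : Wt) : 0 ≤ formNorm B x :=
  Real.sqrt_nonneg _

theorem le_of_isLambdaValue_of_isSpinValue {B : LinearMap.BilinForm ℝ Wt}
    (hB : IsInvariantForm B) {μ : Wt} {r s : ℝ}
    (hr : IsLambdaValue B μ r) (hs : IsSpinValue B μ s) : r ≤ s := by
  obtain ⟨Ψ, hΨ, -, p, hp, rfl⟩ := hr
  obtain ⟨Ψ', hΨ', hc', w, hw, ν, rfl, hν, rfl⟩ := hs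
  rw [formNorm_le_iff hB]
  exact (lambda_le_spin hB hΨ hΨ' hc' hp hw hν).1

theorem exists_isLambdaValue {B : LinearMap.BilinForm ℝ Wt} (hB : IsInvariantForm B) (μ : Wt) :
    ∃ r, IsLambdaValue B μ r := by
  obtain ⟨Ψ, hΨ, hd⟩ := exists_isPositiveSystem_isDominant (μ + (2 : ℝ) • rhoC)
  obtain ⟨p, hp⟩ := exists_isChamberProjection hB Ψ (μ + (2 : ℝ) • rhoC - halfSum Ψ)
  exact ⟨_, Ψ, hΨ, hd, p, hp, rfl⟩

/-- The infimum is attained: each Ψ gives at most one value, and there are finitely many Ψ. -/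
theorem isSpinValue_spinNorm {B : LinearMap.BilinForm ℝ Wt} (hB : IsInvariantForm B) (μ : Wt) :
    IsSpinValue B μ (spinNorm B μ) := by
  classical
  have hne : {r | IsSpinValue B μ r}.Nonempty := by
    obtain ⟨w, hw, hd⟩ := exists_isDominant (μ - halfSum (chamber 0 ∩ noncompactRoots))
    refine ⟨_, chamber 0, isPositiveSystem_chamber 0, posCompactRoots_subset_chamber 0, w, hw,
      _, rfl, ?_, rfl⟩
    convert hd
  refine hne.csInf_mem ?_
  refine Set.Finite.subset (s := ⋃ Ψ ∈ roots.powerset, {r | ∃ w ∈ compactWeylGroup,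
    IsDominant posCompactRoots (w (μ - halfSum (Ψ ∩ noncompactRoots))) ∧
      r = formNorm B (w (μ - halfSum (Ψ ∩ noncompactRoots)) + rhoC)}) ?_ ?_
  · refine Set.Finite.biUnion (Finset.finite_toSet _) fun Ψ _ => Set.Subsingleton.finite ?_
    rintro _ ⟨v, hv, hd, rfl⟩ _ ⟨w, hw, hd', rfl⟩
    generalize μ - halfSum (Ψ ∩ noncompactRoots) = x at *
    have e : (v x + rhoC) ⬝ᵥ (v x + rhoC) = (w x + rhoC) ⬝ᵥ (w x + rhoC) := by
      have e1 := dotProduct_rhoC_eq hv hw hd hd'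
      simp only [add_dotProduct, dotProduct_add, compactWeylGroup_dotProduct hv,
        compactWeylGroup_dotProduct hw, dotProduct_comm rhoC, e1]
    exact le_antisymm ((formNorm_le_iff hB _ _).2 e.le) ((formNorm_le_iff hB _ _).2 e.ge)
  · rintro r ⟨Ψ, hΨ, -, w, hw, ν, rfl, hd, rfl⟩
    refine Set.mem_biUnion (Finset.mem_powerset.2 hΨ.subset_roots) ⟨w, hw, ?_, ?_⟩
    · convert hd
    · congr

theorem spinNorm_eq_lambdaNorm_iff {B : LinearMap.BilinForm ℝ Wt} (hB : IsInvariantForm B) (μ : Wt) :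
    spinNorm B μ = lambdaNorm B μ ↔
      ∃ x, IsDominant (chamber x) (μ + (2 : ℝ) • rhoC - halfSum (chamber x)) ∧
        IsDominant posCompactRoots (μ + rhoC - halfSum (chamber x)) := by
  constructor
  · intro he
    have hs := isSpinValue_spinNorm hB μ
    obtain ⟨r, hr⟩ := exists_isLambdaValue hB μ
    have h1 : spinNorm B μ ≤ r := by
      rw [he]
      -- The infimum is at most any single lambda value r, which suffices; independence of the
      -- choice of Ψ is not needed here.
      exact csInf_le ⟨0, fun _ ⟨_, _, _, p, _, h⟩ => h ▸ formNorm_nonneg B p⟩ hr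
    obtain ⟨Ψ, hΨ, -, p, hp, rfl⟩ := hr
    generalize spinNorm B μ = s at *
    obtain ⟨Ψ', hΨ', hc', w, hw, ν, rfl, hν, rfl⟩ := hs
    rw [formNorm_le_iff hB] at h1
    obtain ⟨x, rfl⟩ := hΨ'.exists_eq_chamber hc'
    exact ⟨x, (lambda_le_spin hB hΨ hΨ' hc' hp hw hν).2 h1⟩
  · rintro ⟨x, h1, h2⟩
    -- μ + 2ρ_c is the dominant η plus the strictly dominant ρ', so it is regular and `chamber x` is
    -- the only positive system making it dominant.
    have hpos : ∀ α ∈ chamber x, 0 < (μ + (2 : ℝ) • rhoC) ⬝ᵥ α := fun α hα => by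
      have h3 := (isDominant_iff _ _).1 h1 α hα
      have h4 := halfSum_chamber_dotProduct_pos hα
      rw [sub_dotProduct] at h3
      linarith
    have hΨ := isPositiveSystem_chamber x
    set η := μ + (2 : ℝ) • rhoC - halfSum (chamber x) with hη
    have hL : {r | IsLambdaValue B μ r} = {formNorm B η} := by
      ext r
      constructor
      · rintro ⟨Ψ, hΨ', hd, p, hp, rfl⟩
        have e : Ψ = chamber x := by
          ext α
          constructor
          · intro hα
            by_contra hn
            have hr := hΨ'.subset_roots hα
            have h3 := hpos _ ((hΨ.neg_mem_iff hr).2 hn)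
            have h4 := (isDominant_iff _ _).1 hd α hα
            rw [dotProduct_neg] at h3
            linarith
          · intro hα
            by_contra hn
            have hr := hΨ.subset_roots hα
            have h3 := (isDominant_iff _ _).1 hd _ ((hΨ'.neg_mem_iff hr).2 hn)
            have h4 := hpos α hα
            rw [dotProduct_neg] at h3
            linarith
        subst e
        rw [Set.mem_singleton_iff, hp.eq_self hB h1]
      · rintro rfl
        refine ⟨chamber x, hΨ, (isDominant_iff _ _).2 fun α hα => (hpos α hα).le, η,
          ⟨h1, fun q _ => ?_⟩, rfl⟩
        rw [formNorm_le_iff hB, sub_self, dotProduct_zero]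
        exact Finset.sum_nonneg fun _ _ => mul_self_nonneg _
    have hl : IsLambdaValue B μ (formNorm B η) := by
      have : formNorm B η ∈ {r | IsLambdaValue B μ r} := by rw [hL]; rfl
      exact this
    have hS : IsLeast {r | IsSpinValue B μ r} (formNorm B η) := by
      refine ⟨⟨chamber x, hΨ, posCompactRoots_subset_chamber x, 1, one_mem _,
        μ + rhoC - halfSum (chamber x), ?_, h2, ?_⟩,
        fun s hs => le_of_isLambdaValue_of_isSpinValue hB hl hs⟩
      · rw [halfSum_inter_noncompactRoots hΨ (posCompactRoots_subset_chamber x)]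
        change _ = μ - _
        abel
      · congr 1
        rw [hη]
        module
    rw [spinNorm, hS.csInf_eq, lambdaNorm, hL, csInf_singleton]

/-! ### The rows of the table. -/

/-- Twice the coordinates of `kWeight m + 2 ρ_c - ρ'`, where `ρ'` is the half sum of `chamber x`. -/
def shiftedWeight (x : Fin 12) (m : Fin 4 → ℤ) : Fin 4 → ℤ :=
  ![m 0 + m 1 + m 2 + m 3 + 8, -m 0 - m 1 - m 2 + m 3 - 4, m 1 + 2 * m 2 + 6, m 1 + 2] - chamberRho x

theorem toWt_shiftedWeight (x : Fin 12) (m : Fin 4 → ℤ) : toWt (shiftedWeight x m) =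
    kWeight m + (2 : ℝ) • rhoC - halfSum (chamber x) := by
  have e : (2 : ℝ) • toWt ![4, -2, 3, 1] = ![4, -2, 3, 1] := by
    funext i
    fin_cases i <;> norm_num [toWt]
  rw [halfSum_chamber, rhoC_eq, kWeight_eq, e]
  funext i
  fin_cases i <;> simp [toWt, shiftedWeight] <;> ring

theorem isDominant_chamber_kWeight_iff (x : Fin 12) (m : Fin 4 → ℤ) :
    IsDominant (chamber x) (kWeight m + (2 : ℝ) • rhoC - halfSum (chamber x)) ↔
      ∀ k, 0 ≤ shiftedWeight x m ⬝ᵥ chamberRoot x k := by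
  rw [← toWt_shiftedWeight, isDominant_chamber_iff]
  refine forall_congr' fun k => ?_
  rw [toWt_dotProduct]
  constructor
  · intro h
    exact_mod_cast (by linarith : (0 : ℝ) ≤ (shiftedWeight x m ⬝ᵥ chamberRoot x k : ℤ))
  · intro h
    positivity

/-- Since ρ_c pairs to 1 with each coroot of γⱼ, the condition is that λ_a pairs to at least 1. In
doubled coordinates the bound is 2, except for γ₂, where it is 1. -/
theorem isDominant_compact_kWeight_iff (x : Fin 12) (m : Fin 4 → ℤ) :
    IsDominant posCompactRoots (kWeight m + rhoC - halfSum (chamber x)) ↔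
      shiftedWeight x m 2 + shiftedWeight x m 3 + 2 ≤ shiftedWeight x m 0 - shiftedWeight x m 1 ∧
      1 ≤ shiftedWeight x m 3 ∧ 2 ≤ shiftedWeight x m 2 - shiftedWeight x m 3 ∧
      2 ≤ shiftedWeight x m 0 + shiftedWeight x m 1 := by
  have e : kWeight m + rhoC - halfSum (chamber x) =
      toWt (shiftedWeight x m) - toWt ![4, -2, 3, 1] := by
    rw [toWt_shiftedWeight, ← rhoC_eq]
    module
  rw [e, isDominant_posCompactRoots_iff]
  generalize shiftedWeight x m = n
  simp [toWt]
  constructor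
  · rintro ⟨h0, h1, h2, h3⟩
    refine ⟨?_, ?_, ?_, ?_⟩
    · exact_mod_cast (by linarith : (n 2 + n 3 + 2 : ℝ) ≤ n 0 - n 1)
    · exact_mod_cast (by linarith : (1 : ℝ) ≤ n 3)
    · exact_mod_cast (by linarith : (2 : ℝ) ≤ n 2 - n 3)
    · exact_mod_cast (by linarith : (2 : ℝ) ≤ n 0 + n 1)
  · rintro ⟨h0, h1, h2, h3⟩
    have g0 : (n 2 + n 3 + 2 : ℝ) ≤ n 0 - n 1 := by exact_mod_cast h0
    have g1 : (1 : ℝ) ≤ n 3 := by exact_mod_cast h1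
    have g2 : (2 : ℝ) ≤ n 2 - n 3 := by exact_mod_cast h2
    have g3 : (2 : ℝ) ≤ n 0 + n 1 := by exact_mod_cast h3
    refine ⟨?_, ?_, ?_, ?_⟩ <;> linarith

/-- The coordinates of `chamberRho x`. -/
theorem chamberRho_eq (x : Fin 12) : chamberRho x =
    (match x with
      | 0 => ![10, -4, 6, 2]
      | 1 => ![10, -6, 4, 2]
      | 2 => ![10, -2, 6, 4]
      | 3 => ![9, -5, 7, 1]
      | 4 => ![11, -3, 5, 1]
      | 5 => ![9, -7, 5, 1]
      | 6 => ![11, -5, 3, 1]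
      | 7 => ![11, -1, 5, 3]
      | 8 => ![7, -5, 9, 1]
      | 9 => ![11, 1, 5, 3]
      | 10 => ![11, 3, 5, 1]
      | 11 => ![11, 5, 3, 1])
    := by
  revert x
  decide +kernel

/-- For F₄ the root lattice is the weight lattice, so the parity condition makes the coordinates a,
b, c, d of λ_a integral. The factors are 4(β, β)/2 for long and short simple roots β. -/
theorem exists_nat_shiftedWeight (x : Fin 12) (m : Fin 4 → ℤ) (hm : Even (m 0 + m 2 + m 3))
    (h : ∀ k, 0 ≤ shiftedWeight x m ⬝ᵥ chamberRoot x k) :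
    ∃ a b c d : ℕ, shiftedWeight x m ⬝ᵥ chamberRoot x 0 = 4 * a ∧
      shiftedWeight x m ⬝ᵥ chamberRoot x 1 = 4 * b ∧
      shiftedWeight x m ⬝ᵥ chamberRoot x 2 = 2 * c ∧
      shiftedWeight x m ⬝ᵥ chamberRoot x 3 = 2 * d := by
  have key {y : ℤ} (k : ℤ) (hk : 0 < k) (hy : 0 ≤ y) (h : k ∣ y) : ∃ a : ℕ, y = k * a := by
    obtain ⟨z, rfl⟩ := h
    obtain ⟨a, rfl⟩ := Int.eq_ofNat_of_zero_le (nonneg_of_mul_nonneg_right hy hk)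
    exact ⟨a, rfl⟩
  have hdvd : 4 ∣ shiftedWeight x m ⬝ᵥ chamberRoot x 0 ∧ 4 ∣ shiftedWeight x m ⬝ᵥ chamberRoot x 1 ∧
      2 ∣ shiftedWeight x m ⬝ᵥ chamberRoot x 2 ∧ 2 ∣ shiftedWeight x m ⬝ᵥ chamberRoot x 3 := by
    clear h key
    rw [shiftedWeight, chamberRho_eq]
    fin_cases x <;> simp [dotProduct, Fin.sum_univ_four, chamberRoot] <;> grind
  obtain ⟨a, ha⟩ := key 4 (by norm_num) (h 0) hdvd.1
  obtain ⟨b, hb⟩ := key 4 (by norm_num) (h 1) hdvd.2.1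
  obtain ⟨c, hc⟩ := key 2 (by norm_num) (h 2) hdvd.2.2.1
  obtain ⟨d, hd⟩ := key 2 (by norm_num) (h 3) hdvd.2.2.2
  exact ⟨a, b, c, d, ha, hb, hc, hd⟩

set_option maxHeartbeats 1000000 in
/-- The weights of row `x` of the table are those for which `λ_a` is computed from `chamber x`
without a projection and is regular for `Δ(k, t)`. -/
theorem tableRow_iff (x : Fin 12) (m : Fin 4 → ℤ) :
    ((∀ i, 0 ≤ m i) ∧ Even (m 0 + m 2 + m 3) ∧
      IsDominant (chamber x) (kWeight m + (2 : ℝ) • rhoC - halfSum (chamber x)) ∧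
      IsDominant posCompactRoots (kWeight m + rhoC - halfSum (chamber x))) ↔
    ∃ a b c d : ℕ, 0 < a + b ∧ 0 < b + c ∧ 0 < c + d ∧ tableCondition x a b c d ∧
      m = tableWeight x a b c d := by
  rw [isDominant_chamber_kWeight_iff, isDominant_compact_kWeight_iff]
  constructor
  · rintro ⟨h0, h1, h2, h3⟩
    obtain ⟨a, b, c, d, ha, hb, hc, hd⟩ := exists_nat_shiftedWeight x m h1 h2
    refine ⟨a, b, c, d, ?_⟩
    have m0 := h0 0
    have m1 := h0 1
    have m2 := h0 2
    have m3 := h0 3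
    clear h0 h1 h2
    rw [shiftedWeight, chamberRho_eq] at ha hb hc hd h3
    -- Of two adjacent simple roots of the chamber, either one is compact or their sum is a compact
    -- root; positivity of λ_a on it gives a + b, b + c, c + d > 0. The row's own condition comes
    -- from its compact simple roots.
    fin_cases x <;>
      simp [dotProduct, Fin.sum_univ_four, chamberRoot] at ha hb hc hd h3 <;>
      refine ⟨by omega, by omega, by omega, by simp only [tableCondition] <;> omega, ?_⟩ <;>
      funext i <;> fin_cases i <;> simp [tableWeight] <;> omega
  · rintro ⟨a, b, c, d, hab, hbc, hcd, hx, rfl⟩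
    rw [shiftedWeight, chamberRho_eq]
    fin_cases x <;> simp only [tableCondition] at hx <;>
      refine ⟨fun i => ?_, ?_, fun k => ?_, ?_⟩
    any_goals fin_cases i <;> simp [tableWeight] <;> omega
    any_goals simp [tableWeight, Int.even_iff]; omega
    any_goals fin_cases k <;> simp [dotProduct, Fin.sum_univ_four, chamberRoot, tableWeight] <;> omega

end FI

theorem mainTheorem8 (B : LinearMap.BilinForm ℝ FI.Wt) (hB : FI.IsInvariantForm B) (μ : FI.Wt) :
    (FI.IsKType μ ∧ FI.spinNorm B μ = FI.lambdaNorm B μ) ↔ FI.IsTableWeight μ := by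
  rw [FI.isKType_iff, FI.spinNorm_eq_lambdaNorm_iff hB]
  constructor
  · rintro ⟨⟨m₀, m₁, m₂, m₃, hm, rfl⟩, x, h⟩
    obtain ⟨a, b, c, d, h1, h2, h3, h4, h5⟩ := (FI.tableRow_iff x ![m₀, m₁, m₂, m₃]).1
      ⟨fun i => by fin_cases i <;> simp, by simpa using mod_cast hm, h⟩
    exact ⟨x, a, b, c, d, h1, h2, h3, h4, congrArg _ h5⟩
  · rintro ⟨x, a, b, c, d, h1, h2, h3, h4, rfl⟩
    obtain ⟨hm, he, h⟩ := (FI.tableRow_iff x _).2 ⟨a, b, c, d, h1, h2, h3, h4, rfl⟩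
    refine ⟨?_, x, h⟩
    obtain ⟨m₀, e0⟩ := Int.eq_ofNat_of_zero_le (hm 0)
    obtain ⟨m₁, e1⟩ := Int.eq_ofNat_of_zero_le (hm 1)
    obtain ⟨m₂, e2⟩ := Int.eq_ofNat_of_zero_le (hm 2)
    obtain ⟨m₃, e3⟩ := Int.eq_ofNat_of_zero_le (hm 3)
    rw [e0, e2, e3] at he
    refine ⟨m₀, m₁, m₂, m₃, by exact_mod_cast he, ?_⟩
    congr 1
    funext i
    fin_cases i
    exacts [e0, e1, e2, e3]
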